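/- Let $K_n$ be the complete graph on $n$ vertices with edge set $E_n$, and let $\omega=(\omega_e)_{e\in E_n}$ be i.i.d. random variables uniformly distributed on $[0,1]$, with law $\mathbb P_n$. For $\beta\ge 0$ and given $\omega$, let $\mathbf P^{\omega}_{n,\beta}$ be the probability measure on the set $\mathbb T(K_n)$ of spanning trees of $K_n$ (identified with their edge sets) given by $$\mathbf P^{\omega}_{n,\beta}(T)=\frac{1}{Z^{\omega}_{\beta}}\prod_{e\in T}e^{-\beta\omega_e},\qquad Z^{\omega}_{\beta}=\sum_{T\in\mathbb T(K_n)}\ \prod_{e\in T}e^{-\beta\omega_e},$$ and let $$\mathcal O(\beta)=\mathcal O_n(\beta,\omega)=\sum_{T,T'\in\mathbb T(K_n)}|T\cap T'|\,\mathbf P^{\omega}_{n,\beta}(T)\,\mathbf P^{\omega}_{n,\beta}(T')$$ be the expected edge overlap of two independent samples in the same environment. (i) Let $\beta=\beta(n)>0$ satisfy $\beta(n)=o(n/\log n)$ as $n\to\infty$. Then there is a deterministic sequence $\delta_n\to0$ such that, with $\mathbb P_n$-probability tending to $1$ as $n\to\infty$, $$\left|\mathcal O(\beta)-\beta\,\frac{1-e^{-2\beta}}{(1-e^{-\beta})^2}\right|\le\delta_n\,\beta\,\frac{1-e^{-2\beta}}{(1-e^{-\beta})^2}.$$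 (ii) Let $\beta=\beta(n)\ge0$ satisfy $n(\log n)^2=o(\beta(n))$ as $n\to\infty$. Then there is a deterministic sequence $\delta_n\to0$ such that, with $\mathbb P_n$-probability tending to $1$ as $n\to\infty$, $$(1-\delta_n)\,n\le\mathcal O(\beta)\le n.$$ -/

import Mathlib

open Filter Topology MeasureTheory Asymptotics

noncomputable section

namespace RSTRE

/-- The edges of the complete graph `K_n` on the vertex set `Fin n`. -/
abbrev Edge (n : ℕ) : Type := (⊤ : SimpleGraph (Fin n)).edgeSet

/-- An environment: a real number `ω e` for every edge of `K_n`. -/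
abbrev Env (n : ℕ) : Type := Edge n → ℝ

/-- The law of the environment: the `ω e` are i.i.d. uniform on `[0, 1]`. -/
def envLaw (n : ℕ) : Measure (Env n) :=
  Measure.pi fun _ : Edge n => (volume : Measure ℝ).restrict (Set.Icc 0 1)

instance (n : ℕ) : IsProbabilityMeasure (envLaw n) := by
  have : IsProbabilityMeasure ((volume : Measure ℝ).restrict (Set.Icc 0 1)) := ⟨by simp⟩
  unfold envLaw
  infer_instance

/-- The graph on all `n` vertices whose edge set is `T`. -/
def graphOf {n : ℕ} (T : Finset (Edge n)) : SimpleGraph (Fin n) :=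
  SimpleGraph.fromEdgeSet {e | ∃ f ∈ T, (f : Sym2 (Fin n)) = e}

open Classical in
/-- The spanning trees of `K_n`, each identified with its set of edges. -/
def spanningTrees (n : ℕ) : Finset (Finset (Edge n)) :=
  {T | (graphOf T).IsTree}

/-- The weight `∏_{e ∈ T} exp (-β ω_e)` of a set of edges. -/
def weight {n : ℕ} (β : ℝ) (ω : Env n) (T : Finset (Edge n)) : ℝ :=
  ∏ e ∈ T, Real.exp (-β * ω e)

/-- The partition function. -/
def partitionFn {n : ℕ} (β : ℝ) (ω : Env n) : ℝ :=
  ∑ T ∈ spanningTrees n, weight β ω T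

/-- The quenched probability that the random spanning tree equals `T`, for a spanning tree `T`. -/
def treeProb {n : ℕ} (β : ℝ) (ω : Env n) (T : Finset (Edge n)) : ℝ :=
  weight β ω T / partitionFn β ω

/-- The expected number of common edges of two independent samples of the random spanning tree in
the same environment `ω`. -/
def overlap {n : ℕ} (β : ℝ) (ω : Env n) : ℝ :=
  ∑ T ∈ spanningTrees n, ∑ T' ∈ spanningTrees n,
    ((T ∩ T').card : ℝ) * treeProb β ω T * treeProb β ω T'

/-- The events `A n` hold with high probability. They are events of the environment, on which the
averaged law of environment and tree is the law of the environment. -/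
def WithHighProbability (A : ∀ n : ℕ, Set (Env n)) : Prop :=
  Tendsto (fun n => envLaw n (A n)) atTop (𝓝 1)

end RSTRE

end

/-! Put `c e = exp (-β ω e)`, let `q` and `q₂` be the means of `c e` and `c e ^ 2`, and let `p e` be
the probability that the tree contains `e`. By independence of the two samples the overlap is `∑ p e
^ 2`, while `∑ p e = n - 1`.

Small `β`. In a nearly homogeneous network `p e ≈ 2 c e / (n q)`, so `∑ p e ^ 2 ≈ (n² / 2) q₂ (2 /
(n q))² = 2 q₂ / q²`, which is the claimed limit. Kirchhoff's theory makes this precise. It is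
derived from the exchange property of trees: the tree sums in `potential` solve the Laplace equation
with poles at the ends of an edge (`sum_cond_potential`). Dirichlet's principle with test function
`1_x - 1_y` gives `p e ≥ l * c e` with `l ≈ 2 / (n q)` (`four_mul_le_mul_marginal`). As `l * ∑ c e`
is already close to `n - 1 = ∑ p e`, the nonnegative errors `p e - l * c e` are small in `ℓ¹`. A
crude bound `p e = O(1 / (n q))` from Cheeger's inequality (`marginal_le_of_expansion`) turns this
into closeness of the sums of squares (`sum_marginal_sq_bounds`). The required cuts, degrees and
moments are typical by Chernoff bounds, because `n q ≥ n / (1 + β)` dominates `log n`.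

Large `β`. Here `n - 1 - overlap = ∑ p e (1 - p e)`. As a function of `ω e` alone, `p e` is logistic
with rate `β`, so `p e (1 - p e)` is `-1 / β` times its derivative and integrates to at most `1 / β`
over `[0, 1]`. The expected deficit is at most `n (n - 1) / (2 β)`, which is `o(n)` once `n = o(β)`;
Markov's inequality concludes. -/

noncomputable section

namespace RSTRE

/-! ### Spanning trees as sets of edges -/

/-- The edge of `K_n` joining two distinct vertices. -/
def mkEdge {n : ℕ} (u v : Fin n) (h : u ≠ v) : Edge n := ⟨s(u, v), by simpa using h⟩

lemma mkEdge_comm {n : ℕ} (u v : Fin n) (h : u ≠ v) : mkEdge u v h = mkEdge v u h.symm :=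
  Subtype.ext Sym2.eq_swap

lemma exists_eq_mkEdge {n : ℕ} (e : Edge n) : ∃ u v, ∃ h : u ≠ v, e = mkEdge u v h := by
  obtain ⟨e, he⟩ := e
  induction e using Sym2.ind with
  | _ u v => exact ⟨u, v, by simpa using he, rfl⟩

lemma mkEdge_eq_iff {n : ℕ} {u v x y : Fin n} (h : u ≠ v) (h' : x ≠ y) :
    mkEdge u v h = mkEdge x y h' ↔ (u = x ∧ v = y) ∨ (u = y ∧ v = x) := by
  simp [mkEdge]

lemma graphOf_adj {n : ℕ} {T : Finset (Edge n)} {u v : Fin n} :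
    (graphOf T).Adj u v ↔ ∃ h : u ≠ v, mkEdge u v h ∈ T := by
  simp only [graphOf, SimpleGraph.fromEdgeSet_adj, Set.mem_ofPred_eq]
  constructor
  · rintro ⟨⟨f, hf, hfe⟩, h⟩
    refine ⟨h, ?_⟩
    have : mkEdge u v h = f := Subtype.ext hfe.symm
    rwa [this]
  · rintro ⟨h, hm⟩
    exact ⟨⟨_, hm, rfl⟩, h⟩

lemma graphOf_mono {n : ℕ} {S T : Finset (Edge n)} (h : S ⊆ T) : graphOf S ≤ graphOf T := by
  intro u v huv
  obtain ⟨hne, hm⟩ := graphOf_adj.1 huv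
  exact graphOf_adj.2 ⟨hne, h hm⟩

lemma card_edgeSet_graphOf {n : ℕ} (T : Finset (Edge n)) :
    Nat.card (graphOf T).edgeSet = T.card := by
  have : (graphOf T).edgeSet = (fun e : Edge n => (e : Sym2 (Fin n))) '' (T : Set (Edge n)) := by
    ext e
    induction e using Sym2.ind with
    | _ u v =>
      rw [SimpleGraph.mem_edgeSet, graphOf_adj]
      constructor
      · rintro ⟨h, hm⟩
        exact ⟨_, hm, rfl⟩
      · rintro ⟨f, hf, hfe⟩
        have hne : u ≠ v := by
          have := f.2
          rw [show (f : Sym2 (Fin n)) = s(u, v) from hfe] at this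
          simpa using this
        exact ⟨hne, by rwa [show mkEdge u v hne = f from Subtype.ext hfe.symm]⟩
  rw [this, Nat.card_image_of_injective Subtype.val_injective]
  simp

lemma mem_spanningTrees {n : ℕ} {T : Finset (Edge n)} :
    T ∈ spanningTrees n ↔ (graphOf T).Connected ∧ T.card + 1 = n := by
  classical
  rw [spanningTrees, Finset.mem_filter, SimpleGraph.isTree_iff_connected_and_card,
    card_edgeSet_graphOf]
  simp

lemma le_card_of_connected {n : ℕ} {T : Finset (Edge n)} (h : (graphOf T).Connected) :
    n ≤ T.card + 1 := by
  have := h.card_vert_le_card_edgeSet_add_one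
  rwa [card_edgeSet_graphOf, Nat.card_eq_fintype_card, Fintype.card_fin] at this

/-- After adding an edge `xy`, every vertex reachable from `u` was reachable from `u`, `x` or
`y`. -/
lemma reachable_insert {n : ℕ} {F : Finset (Edge n)} {x y : Fin n} (h : x ≠ y) {u v : Fin n}
    (hr : (graphOf (insert (mkEdge x y h) F)).Reachable u v) :
    (graphOf F).Reachable u v ∨
      ((graphOf F).Reachable x u ∨ (graphOf F).Reachable y u) ∧
      ((graphOf F).Reachable x v ∨ (graphOf F).Reachable y v) := by
  obtain ⟨p⟩ := hr
  induction p with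
  | nil => exact Or.inl (SimpleGraph.Reachable.refl _)
  | @cons a b c hab _ ih =>
    obtain ⟨hne, hm⟩ := graphOf_adj.1 hab
    rcases Finset.mem_insert.1 hm with he | hF
    · rw [mkEdge_eq_iff] at he
      have hrefl : ∀ z, (graphOf F).Reachable z z := fun z => SimpleGraph.Reachable.refl _
      right
      rcases he with ⟨rfl, rfl⟩ | ⟨rfl, rfl⟩
      · rcases ih with ih | ih
        · exact ⟨Or.inl (hrefl _), Or.inr ih⟩
        · exact ⟨Or.inl (hrefl _), ih.2⟩
      · rcases ih with ih | ih
        · exact ⟨Or.inr (hrefl _), Or.inl ih⟩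
        · exact ⟨Or.inr (hrefl _), ih.2⟩
    · have hr : (graphOf F).Reachable a b :=
        (graphOf_adj.2 ⟨hne, hF⟩ : (graphOf F).Adj a b).reachable
      rcases ih with ih | ⟨h1, h2⟩
      · exact Or.inl (hr.trans ih)
      · exact Or.inr ⟨h1.imp (·.trans hr.symm) (·.trans hr.symm), h2⟩

/-- Deleting an edge `xy` of a tree splits the vertices into those connected to `x` and those
connected to `y`. -/
lemma reachable_or {n : ℕ} {F : Finset (Edge n)} {x y : Fin n} {h : x ≠ y}
    (ht : insert (mkEdge x y h) F ∈ spanningTrees n) (v : Fin n) :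
    (graphOf F).Reachable x v ∨ (graphOf F).Reachable y v := by
  rcases reachable_insert h ((mem_spanningTrees.1 ht).1.preconnected x v) with hr | hr
  · exact Or.inl hr
  · exact hr.2

/-- Otherwise `F` alone would connect all vertices with only `n - 2` edges. -/
lemma not_reachable_endpoints {n : ℕ} {F : Finset (Edge n)} {x y : Fin n} {h : x ≠ y}
    (hF : mkEdge x y h ∉ F) (ht : insert (mkEdge x y h) F ∈ spanningTrees n) :
    ¬ (graphOf F).Reachable x y := by
  intro hr
  have hx : ∀ v, (graphOf F).Reachable x v := fun v =>
    (reachable_or ht v).elim id hr.trans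
  have hc : (graphOf F).Connected :=
    { preconnected := fun u v => (hx u).symm.trans (hx v), nonempty := ⟨x⟩ }
  have h1 := le_card_of_connected hc
  have h2 := (mem_spanningTrees.1 ht).2
  rw [Finset.card_insert_of_notMem hF] at h2
  omega

lemma reachable_iff_not {n : ℕ} {F : Finset (Edge n)} {x y : Fin n} {h : x ≠ y}
    (hF : mkEdge x y h ∉ F) (ht : insert (mkEdge x y h) F ∈ spanningTrees n) (v : Fin n) :
    (graphOf F).Reachable y v ↔ ¬ (graphOf F).Reachable x v :=
  ⟨fun hy hx => not_reachable_endpoints hF ht (hx.trans hy.symm),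
    fun hx => (reachable_or ht v).resolve_left hx⟩

/-- The exchange property of spanning trees. -/
lemma insert_mem_spanningTrees {n : ℕ} {F : Finset (Edge n)} {x y u v : Fin n} {h : x ≠ y}
    {h' : u ≠ v} (hF : mkEdge x y h ∉ F) (ht : insert (mkEdge x y h) F ∈ spanningTrees n)
    (hu : (graphOf F).Reachable x u) (hv : (graphOf F).Reachable y v) :
    mkEdge u v h' ∉ F ∧ insert (mkEdge u v h') F ∈ spanningTrees n := by
  have hle : graphOf F ≤ graphOf (insert (mkEdge u v h') F) :=
    graphOf_mono (Finset.subset_insert _ _)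
  have huv : (graphOf (insert (mkEdge u v h') F)).Adj u v :=
    graphOf_adj.2 ⟨h', Finset.mem_insert_self _ _⟩
  have hxy := ((hu.mono hle).trans huv.reachable).trans (hv.mono hle).symm
  have hx : ∀ w, (graphOf (insert (mkEdge u v h') F)).Reachable x w := fun w =>
    (reachable_or ht w).elim (fun hw => hw.mono hle) (fun hw => hxy.trans (hw.mono hle))
  have hc : (graphOf (insert (mkEdge u v h') F)).Connected :=
    { preconnected := fun a b => (hx a).symm.trans (hx b), nonempty := ⟨x⟩ }
  have h1 := le_card_of_connected hc
  have h2 := (mem_spanningTrees.1 ht).2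
  rw [Finset.card_insert_of_notMem hF] at h2
  have hnot : mkEdge u v h' ∉ F := by
    intro hm
    rw [Finset.insert_eq_of_mem hm] at h1
    omega
  refine ⟨hnot, mem_spanningTrees.2 ⟨hc, ?_⟩⟩
  rw [Finset.card_insert_of_notMem hnot]
  omega

lemma spanningTrees_nonempty {n : ℕ} (hn : 0 < n) : (spanningTrees n).Nonempty := by
  have : Nonempty (Fin n) := ⟨⟨0, hn⟩⟩
  have htop : (⊤ : SimpleGraph (Fin n)).Connected := SimpleGraph.connected_top
  obtain ⟨G, -, hG⟩ := htop.exists_isTree_le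
  classical
  refine ⟨Finset.univ.filter fun e : Edge n => (e : Sym2 (Fin n)) ∈ G.edgeSet, ?_⟩
  have : graphOf (Finset.univ.filter fun e : Edge n => (e : Sym2 (Fin n)) ∈ G.edgeSet) = G := by
    ext u v
    rw [graphOf_adj]
    constructor
    · rintro ⟨h, hm⟩
      simpa [mkEdge] using hm
    · intro h
      exact ⟨h.ne, by simpa [mkEdge] using h⟩
  simp only [spanningTrees, Finset.mem_filter, Finset.mem_univ, true_and]
  rwa [this]

/-! ### The transfer current identity -/

open Classical in
/-- The indicator that `u` and `v` are connected by the edges in `F`. -/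
def conn {n : ℕ} (F : Finset (Edge n)) (u v : Fin n) : ℝ :=
  if (graphOf F).Reachable u v then 1 else 0

lemma conn_comm {n : ℕ} (F : Finset (Edge n)) (u v : Fin n) : conn F u v = conn F v u := by
  classical
  unfold conn
  exact if_congr SimpleGraph.reachable_comm rfl rfl

lemma conn_self {n : ℕ} (F : Finset (Edge n)) (u : Fin n) : conn F u u = 1 := by
  simp [conn]

lemma conn_add_conn {n : ℕ} {F : Finset (Edge n)} {x y : Fin n} {h : x ≠ y}
    (hF : mkEdge x y h ∉ F) (ht : insert (mkEdge x y h) F ∈ spanningTrees n) (v : Fin n) :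
    conn F x v + conn F y v = 1 := by
  have := reachable_iff_not hF ht v
  unfold conn
  split_ifs <;> simp_all

lemma conn_reciprocity_aux {n : ℕ} {F : Finset (Edge n)} {x y u v : Fin n} {h : x ≠ y}
    {h' : u ≠ v} (hF : mkEdge x y h ∉ F) (ht : insert (mkEdge x y h) F ∈ spanningTrees n)
    (hne : conn F x u ≠ conn F x v) :
    mkEdge u v h' ∉ F ∧ insert (mkEdge u v h') F ∈ spanningTrees n := by
  have hu := reachable_iff_not hF ht u
  have hv := reachable_iff_not hF ht v
  by_cases hxu : (graphOf F).Reachable x u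
  · by_cases hxv : (graphOf F).Reachable x v
    · simp [conn, hxu, hxv] at hne
    · exact insert_mem_spanningTrees hF ht hxu (hv.2 hxv)
  · by_cases hxv : (graphOf F).Reachable x v
    · rw [mkEdge_comm]
      exact insert_mem_spanningTrees hF ht hxv (hu.2 hxu)
    · simp [conn, hxu, hxv] at hne

-- Reciprocity for one forest `F` with two components. Both sides vanish unless `xy` and `uv` both
-- join the two components; then both are `1` if `u` lies on the side of `x`, and `-1` otherwise.
open Classical in
lemma conn_reciprocity {n : ℕ} (F : Finset (Edge n)) {x y u v : Fin n} (h : x ≠ y)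
    (h' : u ≠ v) :
    (if mkEdge x y h ∉ F ∧ insert (mkEdge x y h) F ∈ spanningTrees n then
        conn F x u - conn F x v else 0) =
      if mkEdge u v h' ∉ F ∧ insert (mkEdge u v h') F ∈ spanningTrees n then
        conn F u x - conn F u y else 0 := by
  split_ifs with h1 h2 h2
  · have a := conn_add_conn h1.1 h1.2 u
    have b := conn_add_conn h2.1 h2.2 x
    have c := conn_comm F x u
    have d := conn_comm F x v
    have e := conn_comm F y u
    linarith
  · by_contra hne
    exact h2 (conn_reciprocity_aux h1.1 h1.2 (fun h => hne (by rw [h, sub_self])))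
  · by_contra hne
    exact h1 (conn_reciprocity_aux h2.1 h2.2 (fun h => hne (by rw [h, sub_self])))
  · rfl

lemma sum_spanningTrees_filter_mem {n : ℕ} (e : Edge n) (H : Finset (Edge n) → ℝ) :
    ∑ T ∈ (spanningTrees n).filter (e ∈ ·), H (T.erase e) =
      ∑ F, if e ∉ F ∧ insert e F ∈ spanningTrees n then H F else 0 := by
  rw [← Finset.sum_filter]
  refine Finset.sum_nbij' (fun T => T.erase e) (fun F => insert e F) ?_ ?_ ?_ ?_ ?_
  · intro T hT
    rw [Finset.mem_filter] at hT
    simp [Finset.insert_erase hT.2, hT.1]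
  · intro F hF
    simp only [Finset.mem_filter, Finset.mem_univ, true_and] at hF
    simp [hF.2]
  · intro T hT
    rw [Finset.mem_filter] at hT
    exact Finset.insert_erase hT.2
  · intro F hF
    simp only [Finset.mem_filter, Finset.mem_univ, true_and] at hF
    exact Finset.erase_insert hF.1
  · intro T hT
    rfl

/-- The product of edge weights over a set of edges. -/
def prodWeight {n : ℕ} (c : Edge n → ℝ) (T : Finset (Edge n)) : ℝ := ∏ e ∈ T, c e

/-- Symmetry of the transfer current. Writing each tree through an edge as that edge plus a
two-component forest turns both sides into sums over forests, which agree term by term by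
`conn_reciprocity`. -/
lemma transfer_reciprocity {n : ℕ} (c : Edge n → ℝ) {x y u v : Fin n} (h : x ≠ y)
    (h' : u ≠ v) :
    c (mkEdge u v h') * ∑ T ∈ (spanningTrees n).filter (mkEdge x y h ∈ ·), prodWeight c T *
        (conn (T.erase (mkEdge x y h)) x u - conn (T.erase (mkEdge x y h)) x v) =
      c (mkEdge x y h) * ∑ T ∈ (spanningTrees n).filter (mkEdge u v h' ∈ ·), prodWeight c T *
        (conn (T.erase (mkEdge u v h')) u x - conn (T.erase (mkEdge u v h')) u y) := by
  have key : ∀ (a b p q : Fin n) (hab : a ≠ b),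
      ∑ T ∈ (spanningTrees n).filter (mkEdge a b hab ∈ ·), prodWeight c T *
        (conn (T.erase (mkEdge a b hab)) a p - conn (T.erase (mkEdge a b hab)) a q) =
      c (mkEdge a b hab) * ∑ F, prodWeight c F *
        if mkEdge a b hab ∉ F ∧ insert (mkEdge a b hab) F ∈ spanningTrees n then
          conn F a p - conn F a q else 0 := by
    intro a b p q hab
    have := sum_spanningTrees_filter_mem (mkEdge a b hab)
      (fun F => c (mkEdge a b hab) * prodWeight c F * (conn F a p - conn F a q))
    simp only [Finset.mul_sum]
    convert this using 1
    · refine Finset.sum_congr rfl fun T hT => ?_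
      rw [prodWeight, prodWeight, Finset.mul_prod_erase _ _ (Finset.mem_filter.1 hT).2]
    · refine Finset.sum_congr rfl fun F _ => ?_
      split_ifs <;> ring
  rw [key, key]
  simp only [conn_reciprocity _ h h']
  ring

/-- The increments of `f` along the path of `T` from `x` to `y` telescope. -/
lemma sum_conn_telescope {n : ℕ} {T : Finset (Edge n)} (hT : T ∈ spanningTrees n)
    (f : Fin n → ℝ) (x y : Fin n) :
    ∑ u, ∑ v, (if h : u ≠ v then
      (if mkEdge u v h ∈ T then (conn (T.erase (mkEdge u v h)) u x -
        conn (T.erase (mkEdge u v h)) u y) * (f u - f v) else 0) else 0) =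
      2 * (f x - f y) := by
  have hr := (mem_spanningTrees.1 hT).1.preconnected x y
  obtain ⟨p⟩ := hr
  induction p with
  | nil => simp
  | @cons a b y hab _ ih =>
    obtain ⟨hne, hm⟩ := graphOf_adj.1 hab
    have hins : insert (mkEdge a b hne) (T.erase (mkEdge a b hne)) ∈ spanningTrees n := by
      rwa [Finset.insert_erase hm]
    have hnr := not_reachable_endpoints (Finset.notMem_erase _ _) hins
    -- Since `ab` is an edge of `T`, deleting any other edge leaves `a` and `b` connected. Only the
    -- two orientations of `ab` contribute, whence the factor 2.
    have hstep : ∑ u, ∑ v, (if h : u ≠ v then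
        (if mkEdge u v h ∈ T then (conn (T.erase (mkEdge u v h)) u a -
          conn (T.erase (mkEdge u v h)) u b) * (f u - f v) else 0) else 0) =
        ∑ u, ∑ v, ((if u = a then (if v = b then f a - f b else 0) else 0) +
          (if u = b then (if v = a then f a - f b else 0) else 0)) := by
      refine Finset.sum_congr rfl fun u _ => Finset.sum_congr rfl fun v _ => ?_
      by_cases h1 : u = a ∧ v = b
      · obtain ⟨rfl, rfl⟩ := h1
        simp [hne, hm, conn, hnr]
      by_cases h2 : u = b ∧ v = a
      · obtain ⟨rfl, rfl⟩ := h2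
        have hnr' : ¬ (graphOf (T.erase (mkEdge u v hne.symm))).Reachable u v := by
          rw [mkEdge_comm]; exact fun h => hnr h.symm
        have hm' : mkEdge u v hne.symm ∈ T := by rwa [mkEdge_comm]
        simp [hne.symm, hm', conn, hnr']
      have hR : ((if u = a then (if v = b then f a - f b else 0) else 0) +
          (if u = b then (if v = a then f a - f b else 0) else 0)) = 0 := by
        split_ifs <;> simp_all
      rw [hR]
      split_ifs with huv huvT
      · have hadj : (graphOf (T.erase (mkEdge u v huv))).Adj a b := by
          refine graphOf_adj.2 ⟨hne, Finset.mem_erase.2 ⟨?_, hm⟩⟩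
          rw [Ne, mkEdge_eq_iff]
          rintro (⟨rfl, rfl⟩ | ⟨rfl, rfl⟩) <;> simp_all
        have : conn (T.erase (mkEdge u v huv)) u a = conn (T.erase (mkEdge u v huv)) u b := by
          have hiff : (graphOf (T.erase (mkEdge u v huv))).Reachable u a ↔
              (graphOf (T.erase (mkEdge u v huv))).Reachable u b :=
            ⟨fun h => h.trans hadj.reachable, fun h => h.trans hadj.reachable.symm⟩
          classical
          unfold conn
          exact if_congr hiff rfl rfl
        rw [this, sub_self, zero_mul]
      · rfl
      · rfl
    have hstep' : ∑ u : Fin n, ∑ v : Fin n,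
        ((if u = a then (if v = b then f a - f b else 0) else 0) +
          (if u = b then (if v = a then f a - f b else 0) else 0)) = 2 * (f a - f b) := by
      simp [Finset.sum_add_distrib]
      ring
    have hsum : ∑ u, ∑ v, (if h : u ≠ v then
        (if mkEdge u v h ∈ T then (conn (T.erase (mkEdge u v h)) u a -
          conn (T.erase (mkEdge u v h)) u y) * (f u - f v) else 0) else 0) =
        ∑ u, ∑ v, (if h : u ≠ v then
        (if mkEdge u v h ∈ T then (conn (T.erase (mkEdge u v h)) u a -
          conn (T.erase (mkEdge u v h)) u b) * (f u - f v) else 0) else 0) +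
        ∑ u, ∑ v, (if h : u ≠ v then
        (if mkEdge u v h ∈ T then (conn (T.erase (mkEdge u v h)) u b -
          conn (T.erase (mkEdge u v h)) u y) * (f u - f v) else 0) else 0) := by
      rw [← Finset.sum_add_distrib]
      refine Finset.sum_congr rfl fun u _ => ?_
      rw [← Finset.sum_add_distrib]
      refine Finset.sum_congr rfl fun v _ => ?_
      split_ifs <;> ring
    rw [hsum, hstep, hstep', ih]
    ring

/-! ### Dirichlet form and edge marginals -/

/-- The conductance between two vertices. -/
def cond {n : ℕ} (c : Edge n → ℝ) (u v : Fin n) : ℝ :=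
  if h : u ≠ v then c (mkEdge u v h) else 0

lemma cond_comm {n : ℕ} (c : Edge n → ℝ) (u v : Fin n) : cond c u v = cond c v u := by
  by_cases h : u = v
  · rw [h]
  · rw [cond, cond, dif_pos h, dif_pos (Ne.symm h), mkEdge_comm]

/-- The total weight of the spanning trees containing `e`. -/
def treesThrough {n : ℕ} (c : Edge n → ℝ) (e : Edge n) : ℝ :=
  ∑ T ∈ (spanningTrees n).filter (e ∈ ·), prodWeight c T

/-- The total weight of the spanning trees. -/
def treesTotal {n : ℕ} (c : Edge n → ℝ) : ℝ := ∑ T ∈ spanningTrees n, prodWeight c T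

/-- The voltage at `u`, up to a factor, of the electrical flow through `xy`. -/
def potential {n : ℕ} (c : Edge n → ℝ) (x y : Fin n) (h : x ≠ y) (u : Fin n) : ℝ :=
  ∑ T ∈ (spanningTrees n).filter (mkEdge x y h ∈ ·),
    prodWeight c T * conn (T.erase (mkEdge x y h)) x u

lemma potential_left {n : ℕ} (c : Edge n → ℝ) (x y : Fin n) (h : x ≠ y) :
    potential c x y h x = treesThrough c (mkEdge x y h) := by
  simp [potential, treesThrough, conn_self]

lemma potential_right {n : ℕ} (c : Edge n → ℝ) (x y : Fin n) (h : x ≠ y) :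
    potential c x y h y = 0 := by
  refine Finset.sum_eq_zero fun T hT => ?_
  obtain ⟨hT, hm⟩ := Finset.mem_filter.1 hT
  have hins : insert (mkEdge x y h) (T.erase (mkEdge x y h)) ∈ spanningTrees n := by
    rwa [Finset.insert_erase hm]
  have hnr := not_reachable_endpoints (Finset.notMem_erase _ _) hins
  simp [conn, hnr]

/-- The weak form of the Laplace equation: `potential` is the voltage of a flow from `x` to `y` of
strength `c (xy) * treesTotal c`. Reciprocity replaces its gradient along `uv` by the signed
passages of tree paths from `x` to `y` through `uv`, and along each tree the increments of `f`
telescope. -/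
lemma sum_cond_potential {n : ℕ} (c : Edge n → ℝ) (x y : Fin n) (h : x ≠ y) (f : Fin n → ℝ) :
    ∑ u, ∑ v, cond c u v * (f u - f v) * (potential c x y h u - potential c x y h v) =
      2 * (c (mkEdge x y h) * treesTotal c * (f x - f y)) := by
  have h1 : ∀ u v, cond c u v * (f u - f v) * (potential c x y h u - potential c x y h v) =
      c (mkEdge x y h) * ∑ T ∈ spanningTrees n, prodWeight c T * (if h : u ≠ v then
      (if mkEdge u v h ∈ T then (conn (T.erase (mkEdge u v h)) u x -
        conn (T.erase (mkEdge u v h)) u y) * (f u - f v) else 0) else 0) := by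
    intro u v
    by_cases huv : u ≠ v
    · have := transfer_reciprocity c h huv
      simp only [mul_sub, Finset.sum_sub_distrib] at this
      simp only [cond, dif_pos huv, potential]
      have h2 : c (mkEdge x y h) * ∑ T ∈ spanningTrees n, prodWeight c T *
          (if mkEdge u v huv ∈ T then (conn (T.erase (mkEdge u v huv)) u x -
            conn (T.erase (mkEdge u v huv)) u y) * (f u - f v) else 0) =
          (c (mkEdge x y h) * ∑ T ∈ (spanningTrees n).filter (mkEdge u v huv ∈ ·),
            (prodWeight c T * conn (T.erase (mkEdge u v huv)) u x -
              prodWeight c T * conn (T.erase (mkEdge u v huv)) u y)) * (f u - f v) := by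
        rw [Finset.sum_filter, mul_assoc, Finset.sum_mul]
        congr 1
        refine Finset.sum_congr rfl fun T _ => ?_
        split_ifs <;> ring
      rw [h2, Finset.sum_sub_distrib, mul_sub (c (mkEdge x y h)), ← this]
      ring
    · simp [cond, huv]
  simp only [h1, ← Finset.mul_sum]
  have h3 : ∑ u, ∑ v, ∑ T ∈ spanningTrees n, prodWeight c T * (if h : u ≠ v then
      (if mkEdge u v h ∈ T then (conn (T.erase (mkEdge u v h)) u x -
        conn (T.erase (mkEdge u v h)) u y) * (f u - f v) else 0) else 0) =
      ∑ T ∈ spanningTrees n, prodWeight c T * (2 * (f x - f y)) := by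
    calc _ = ∑ u, ∑ T ∈ spanningTrees n, ∑ v, prodWeight c T * (if h : u ≠ v then
          (if mkEdge u v h ∈ T then (conn (T.erase (mkEdge u v h)) u x -
          conn (T.erase (mkEdge u v h)) u y) * (f u - f v) else 0) else 0) :=
          Finset.sum_congr rfl fun u _ => Finset.sum_comm
      _ = _ := by
        rw [Finset.sum_comm]
        refine Finset.sum_congr rfl fun T hT => ?_
        rw [← sum_conn_telescope hT f x y]
        simp only [Finset.mul_sum]
  rw [h3, ← Finset.sum_mul, ← treesTotal]
  ring

/-- Twice the Dirichlet energy of `f`. -/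
def energy {n : ℕ} (c : Edge n → ℝ) (f : Fin n → ℝ) : ℝ :=
  ∑ u, ∑ v, cond c u v * (f u - f v) ^ 2

lemma energy_potential {n : ℕ} (c : Edge n → ℝ) (x y : Fin n) (h : x ≠ y) :
    energy c (potential c x y h) =
      2 * (c (mkEdge x y h) * treesTotal c * treesThrough c (mkEdge x y h)) := by
  have := sum_cond_potential c x y h (potential c x y h)
  rw [potential_left, potential_right, sub_zero] at this
  rw [← this, energy]
  simp only [sq, mul_assoc]

section

variable {n : ℕ} {c : Edge n → ℝ}

lemma cond_nonneg (hc : ∀ e, 0 < c e) (u v : Fin n) : 0 ≤ cond c u v := by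
  unfold cond; split_ifs
  · exact (hc _).le
  · exact le_rfl

lemma prodWeight_pos (hc : ∀ e, 0 < c e) (T : Finset (Edge n)) : 0 < prodWeight c T :=
  Finset.prod_pos fun e _ => hc e

lemma treesThrough_nonneg (hc : ∀ e, 0 < c e) (e : Edge n) : 0 ≤ treesThrough c e :=
  Finset.sum_nonneg fun T _ => (prodWeight_pos hc T).le

lemma treesTotal_pos (hc : ∀ e, 0 < c e) (hn : 0 < n) : 0 < treesTotal c :=
  Finset.sum_pos (fun T _ => prodWeight_pos hc T) (spanningTrees_nonempty hn)

/-- Dirichlet's principle bounds the marginal of an edge from below. -/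
lemma mul_sq_le_energy_mul (hc : ∀ e, 0 < c e) (hn : 0 < n) (x y : Fin n) (h : x ≠ y)
    (f : Fin n → ℝ) :
    2 * c (mkEdge x y h) * treesTotal c * (f x - f y) ^ 2 ≤
      energy c f * treesThrough c (mkEdge x y h) := by
  have hZ := treesTotal_pos hc hn
  -- Cauchy–Schwarz for the Dirichlet form, applied to `f` and the potential; both the mixed term
  -- and the energy of the potential are known exactly.
  have hcs := Finset.sum_mul_sq_le_sq_mul_sq (Finset.univ : Finset (Fin n × Fin n))
    (fun p => √(cond c p.1 p.2) * (f p.1 - f p.2))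
    (fun p => √(cond c p.1 p.2) * (potential c x y h p.1 - potential c x y h p.2))
  have e1 : ∀ g : Fin n → ℝ, ∑ p : Fin n × Fin n, (√(cond c p.1 p.2) * (g p.1 - g p.2)) ^ 2 =
      energy c g := by
    intro g
    rw [energy, Fintype.sum_prod_type]
    refine Finset.sum_congr rfl fun u _ => Finset.sum_congr rfl fun v _ => ?_
    rw [mul_pow, Real.sq_sqrt (cond_nonneg hc _ _)]
  have e2 : ∑ p : Fin n × Fin n, √(cond c p.1 p.2) * (f p.1 - f p.2) *
      (√(cond c p.1 p.2) * (potential c x y h p.1 - potential c x y h p.2)) =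
      2 * (c (mkEdge x y h) * treesTotal c * (f x - f y)) := by
    rw [← sum_cond_potential, Fintype.sum_prod_type]
    refine Finset.sum_congr rfl fun u _ => Finset.sum_congr rfl fun v _ => ?_
    rw [show ∀ s a b : ℝ, s * a * (s * b) = (s * s) * a * b by intros; ring,
      Real.mul_self_sqrt (cond_nonneg hc _ _)]
  rw [e1, e1, e2, energy_potential] at hcs
  have hpos : 0 < 2 * (c (mkEdge x y h) * treesTotal c) := by
    have := hc (mkEdge x y h); positivity
  refine le_of_mul_le_mul_left ?_ hpos
  calc _ = (2 * (c (mkEdge x y h) * treesTotal c * (f x - f y))) ^ 2 := by ring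
    _ ≤ _ := hcs
    _ = _ := by ring

/-- A Poincaré inequality bounds the marginal of an edge from above. -/
lemma treesThrough_le (hc : ∀ e, 0 < c e) (x y : Fin n) (h : x ≠ y) {R : ℝ}
    (hR : ∀ f : Fin n → ℝ, (f x - f y) ^ 2 ≤ R * energy c f) :
    treesThrough c (mkEdge x y h) ≤ 2 * R * c (mkEdge x y h) * treesTotal c := by
  have h1 := hR (potential c x y h)
  rw [potential_left, potential_right, sub_zero, energy_potential] at h1
  rcases (treesThrough_nonneg hc (mkEdge x y h)).eq_or_lt with h0 | h0
  · rw [← h0]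
    -- When no weight passes through the edge one cannot divide by it, and the claim reduces to `0 ≤
    -- R`; a point mass at `x` shows this.
    have h2 := hR (Pi.single x 1)
    have h3 : 0 ≤ energy c (Pi.single x 1) := Finset.sum_nonneg fun u _ =>
      Finset.sum_nonneg fun v _ => mul_nonneg (cond_nonneg hc u v) (sq_nonneg _)
    have h4 : 0 ≤ treesTotal c := Finset.sum_nonneg fun T _ => (prodWeight_pos hc T).le
    have h5 : 0 ≤ R := by
      by_contra hlt
      have : (1 : ℝ) ≤ R * energy c (Pi.single x 1) := by simpa [h.symm] using h2
      nlinarith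
    have := (hc (mkEdge x y h)).le
    positivity
  · refine le_of_mul_le_mul_right ?_ h0
    linarith

end

/-! ### Cheeger's inequality -/

section Cheeger

variable {V : Type*} [Fintype V] [DecidableEq V] {c : V → V → ℝ}

/-- The total conductance between a set of vertices and its complement. -/
def cut (c : V → V → ℝ) (S : Finset V) : ℝ := ∑ u ∈ S, ∑ v ∈ Sᶜ, c u v

lemma sum_abs_indicator (hsymm : ∀ u v, c u v = c v u) (S : Finset V) :
    ∑ u, ∑ v, c u v * |(if u ∈ S then (1 : ℝ) else 0) - (if v ∈ S then 1 else 0)| =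
      2 * cut c S := by
  have h : ∀ u v, c u v * |(if u ∈ S then (1 : ℝ) else 0) - (if v ∈ S then 1 else 0)| =
      (if u ∈ S then (if v ∈ Sᶜ then c u v else 0) else 0) +
        (if v ∈ S then (if u ∈ Sᶜ then c v u else 0) else 0) := by
    intro u v
    by_cases hu : u ∈ S <;> by_cases hv : v ∈ S <;> simp [hu, hv, hsymm u v]
  simp only [h, Finset.sum_add_distrib]
  have h1 : ∑ u, ∑ v, (if u ∈ S then (if v ∈ Sᶜ then c u v else 0) else 0) = cut c S := by
    rw [cut, ← Finset.sum_filter_add_sum_filter_not Finset.univ (· ∈ S)]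
    rw [Finset.sum_eq_zero (s := Finset.univ.filter (· ∉ S)), add_zero]
    · refine Finset.sum_congr (by ext; simp) fun u hu => ?_
      simp only [hu, if_true]
      rw [← Finset.sum_filter]
      exact Finset.sum_congr (by ext; simp) fun _ _ => rfl
    · intro u hu
      simp [(Finset.mem_filter.1 hu).2]
  rw [h1, Finset.sum_comm, h1]
  ring

/-- The co-area inequality: an edge expansion bound for the level sets of `F` bounds its total
variation from below. -/
lemma mul_sum_le_total_variation (hsymm : ∀ u v, c u v = c v u) {κ : ℝ} {k : ℕ}
    (hcut : ∀ S : Finset V, S.card ≤ k → κ * S.card ≤ cut c S) (F : V → ℝ) (hF : ∀ v, 0 ≤ F v)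
    (hk : (Finset.univ.filter fun v => 0 < F v).card ≤ k) :
    2 * κ * ∑ v, F v ≤ ∑ u, ∑ v, c u v * |F u - F v| := by
  induction hm : (Finset.univ.filter fun v => 0 < F v).card using Nat.strong_induction_on
    generalizing F with
  | _ m ih =>
  set S := Finset.univ.filter fun v => 0 < F v with hS
  have hmem : ∀ v, v ∈ S ↔ 0 < F v := fun v => by simp [hS]
  rcases S.eq_empty_or_nonempty with h0 | hne
  · have hz : ∀ v, F v = 0 := fun v => by
      have : ¬ 0 < F v := by rw [← hmem, h0]; simp
      exact le_antisymm (not_lt.1 this) (hF v)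
    simp [hz]
  obtain ⟨w, hw, hmin⟩ := S.exists_min_image F hne
  set a := F w
  have ha : 0 < a := (hmem w).1 hw
  -- Peel off the lowest layer: `F = G + a 1_S` with `a` the least positive value. The total
  -- variation is additive in this splitting, and `G` has smaller support.
  set G : V → ℝ := fun v => F v - (if v ∈ S then a else 0) with hG
  have hz : ∀ v, v ∉ S → F v = 0 := fun v hv =>
    le_antisymm (not_lt.1 (fun h => hv ((hmem v).2 h))) (hF v)
  have hG0 : ∀ v, 0 ≤ G v := by
    intro v
    by_cases hv : v ∈ S
    · simp [hG, hv, hmin v hv]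
    · simp [hG, hv, hF v]
  have hlt : (Finset.univ.filter fun v => 0 < G v) ⊂ S := by
    rw [Finset.ssubset_iff_of_subset]
    · exact ⟨w, hw, by simp [hG, hw, a]⟩
    · intro v hv
      by_contra hvS
      simp [hG, hvS, hz v hvS] at hv
  have hlt' := Finset.card_lt_card hlt
  have hi := ih _ (hm ▸ hlt') G hG0 (hlt'.le.trans hk) rfl
  have hsum : ∑ v, F v = ∑ v, G v + a * S.card := by
    simp [hG, mul_comm]
  have habs : ∀ u v, |F u - F v| = |G u - G v| +
      a * |(if u ∈ S then (1 : ℝ) else 0) - (if v ∈ S then 1 else 0)| := by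
    intro u v
    by_cases hu : u ∈ S <;> by_cases hv : v ∈ S
    · simp [hG, hu, hv]
    · have := hmin u hu
      simp only [hG, hu, hv, hz v hv, if_true, if_false, sub_zero, abs_one, mul_one]
      rw [abs_of_nonneg (hF u), abs_of_nonneg (by linarith)]; ring
    · have := hmin v hv
      simp only [hG, hu, hv, hz u hu, if_true, if_false, zero_sub, sub_zero, abs_neg, abs_one,
        mul_one]
      rw [abs_of_nonneg (hF v), abs_of_nonneg (by linarith)]; ring
    · simp [hG, hu, hv]
  have htv : ∑ u, ∑ v, c u v * |F u - F v| =
      ∑ u, ∑ v, c u v * |G u - G v| + a * (2 * cut c S) := by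
    rw [← sum_abs_indicator hsymm, Finset.mul_sum, ← Finset.sum_add_distrib]
    refine Finset.sum_congr rfl fun u _ => ?_
    rw [Finset.mul_sum, ← Finset.sum_add_distrib]
    refine Finset.sum_congr rfl fun v _ => ?_
    rw [habs]; ring
  have hS' := mul_le_mul_of_nonneg_left (hcut S hk) ha.le
  rw [htv, hsum]
  linarith

/-- Cheeger's inequality for functions supported on at most `k` vertices. -/
lemma sum_sq_le_of_support (hsymm : ∀ u v, c u v = c v u) (hc : ∀ u v, 0 ≤ c u v) {κ D : ℝ}
    (hκ : 0 < κ) {k : ℕ} (hcut : ∀ S : Finset V, S.card ≤ k → κ * S.card ≤ cut c S)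
    (hD : ∀ u, ∑ v, c u v ≤ D) (g : V → ℝ) (hg : ∀ v, 0 ≤ g v)
    (hk : (Finset.univ.filter fun v => 0 < g v).card ≤ k) :
    κ ^ 2 * ∑ v, g v ^ 2 ≤ D * ∑ u, ∑ v, c u v * (g u - g v) ^ 2 := by
  have hsup : (Finset.univ.filter fun v => 0 < g v ^ 2) = Finset.univ.filter fun v => 0 < g v := by
    ext v
    simp only [Finset.mem_filter, Finset.mem_univ, true_and]
    exact ⟨fun h => (hg v).lt_of_ne (fun h0 => by simp [← h0] at h), fun h => by positivity⟩
  have h1 := mul_sum_le_total_variation hsymm hcut (fun v => g v ^ 2) (fun v => sq_nonneg _)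
    (by rwa [hsup])
  set A := ∑ v, g v ^ 2
  set E := ∑ u, ∑ v, c u v * (g u - g v) ^ 2 with hE
  have hE0 : 0 ≤ E := Finset.sum_nonneg fun u _ => Finset.sum_nonneg fun v _ =>
    mul_nonneg (hc u v) (sq_nonneg _)
  have hA0 : 0 ≤ A := Finset.sum_nonneg fun v _ => sq_nonneg _
  -- The co-area bound is used for `g ^ 2`; factoring `g u ^ 2 - g v ^ 2` separates the energy from
  -- a term of size at most `4 * D * A`.
  have hcs := Finset.sum_mul_sq_le_sq_mul_sq (Finset.univ : Finset (V × V))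
    (fun p => √(c p.1 p.2) * |g p.1 - g p.2|) (fun p => √(c p.1 p.2) * |g p.1 + g p.2|)
  have e1 : ∑ p : V × V, √(c p.1 p.2) * |g p.1 - g p.2| * (√(c p.1 p.2) * |g p.1 + g p.2|) =
      ∑ u, ∑ v, c u v * |g u ^ 2 - g v ^ 2| := by
    rw [Fintype.sum_prod_type]
    refine Finset.sum_congr rfl fun u _ => Finset.sum_congr rfl fun v _ => ?_
    rw [show ∀ s a b : ℝ, s * a * (s * b) = (s * s) * (a * b) by intros; ring,
      Real.mul_self_sqrt (hc _ _), ← abs_mul]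
    congr 2; ring
  have e2 : ∑ p : V × V, (√(c p.1 p.2) * |g p.1 - g p.2|) ^ 2 = E := by
    rw [hE, Fintype.sum_prod_type]
    refine Finset.sum_congr rfl fun u _ => Finset.sum_congr rfl fun v _ => ?_
    rw [mul_pow, Real.sq_sqrt (hc _ _), sq_abs]
  have e3 : ∑ p : V × V, (√(c p.1 p.2) * |g p.1 + g p.2|) ^ 2 ≤ 4 * D * A := by
    have hle : ∀ u v, (√(c u v) * |g u + g v|) ^ 2 ≤
        2 * (c u v * g u ^ 2) + 2 * (c v u * g v ^ 2) := by
      intro u v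
      rw [mul_pow, Real.sq_sqrt (hc _ _), sq_abs, hsymm v u]
      nlinarith [mul_nonneg (hc u v) (sq_nonneg (g u - g v))]
    have hd : ∑ u, ∑ v, c u v * g u ^ 2 ≤ D * A := by
      rw [Finset.mul_sum]
      refine Finset.sum_le_sum fun u _ => ?_
      rw [← Finset.sum_mul]
      exact mul_le_mul_of_nonneg_right (hD u) (sq_nonneg _)
    calc _ ≤ ∑ p : V × V, (2 * (c p.1 p.2 * g p.1 ^ 2) + 2 * (c p.2 p.1 * g p.2 ^ 2)) :=
          Finset.sum_le_sum fun p _ => hle p.1 p.2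
      _ = 2 * ∑ u, ∑ v, c u v * g u ^ 2 + 2 * ∑ u, ∑ v, c u v * g u ^ 2 := by
        rw [Finset.sum_add_distrib, ← Finset.mul_sum, ← Finset.mul_sum, Fintype.sum_prod_type,
          Fintype.sum_prod_type_right]
      _ ≤ _ := by linarith
  rw [e1, e2] at hcs
  have h2 : (2 * κ * A) ^ 2 ≤ E * (4 * D * A) :=
    calc _ ≤ (∑ u, ∑ v, c u v * |g u ^ 2 - g v ^ 2|) ^ 2 := by
          gcongr
      _ ≤ _ := hcs
      _ ≤ _ := mul_le_mul_of_nonneg_left e3 hE0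
  rcases hA0.eq_or_lt with h0 | h0
  · rw [← h0, mul_zero]
    -- The degree bound forces `0 ≤ D` only if there is a vertex; without one the energy is an empty
    -- sum.
    have hD0 : 0 ≤ D ∨ IsEmpty V := by
      rcases isEmpty_or_nonempty V with h | ⟨⟨v⟩⟩
      · exact Or.inr h
      · exact Or.inl ((Finset.sum_nonneg fun w _ => hc v w).trans (hD v))
    rcases hD0 with hD0 | hV
    · positivity
    · simp [hE]
  · refine le_of_mul_le_mul_right ?_ h0
    nlinarith

/-- Take the least value of `f` with at most half of the vertices strictly above it. If more than
half were strictly below, the next lower value would qualify too. -/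
lemma exists_median [Nonempty V] (f : V → ℝ) : ∃ m : ℝ,
    2 * (Finset.univ.filter fun v => m < f v).card ≤ Fintype.card V ∧
      2 * (Finset.univ.filter fun v => f v < m).card ≤ Fintype.card V := by
  set S := Finset.univ.filter fun w =>
    2 * (Finset.univ.filter fun v => f w < f v).card ≤ Fintype.card V with hS
  have hne : S.Nonempty := by
    obtain ⟨w, -, hw⟩ := Finset.univ.exists_max_image f Finset.univ_nonempty
    refine ⟨w, ?_⟩
    have : (Finset.univ.filter fun v => f w < f v) = ∅ := by
      ext v; simp [hw v (Finset.mem_univ v)]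
    simp [hS, this]
  obtain ⟨w, hw, hmin⟩ := S.exists_min_image f hne
  refine ⟨f w, by simpa [hS] using hw, ?_⟩
  by_contra hlt
  push Not at hlt
  set L := Finset.univ.filter fun v => f v < f w
  have hL : L.Nonempty := by
    rw [← Finset.card_pos]; omega
  obtain ⟨z, hz, hmax⟩ := L.exists_max_image f hL
  have hzw : f z < f w := by simpa [L] using hz
  have hsub : (Finset.univ.filter fun v => f z < f v) ⊆ Lᶜ := by
    intro v hv
    rw [Finset.mem_compl]
    intro hvL
    have := hmax v hvL
    simp only [Finset.mem_filter, Finset.mem_univ, true_and] at hv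
    linarith
  have h1 := Finset.card_le_card hsub
  rw [Finset.card_compl] at h1
  have h2 : z ∈ S := by
    simp only [hS, Finset.mem_filter, Finset.mem_univ, true_and]
    omega
  linarith [hmin z h2]

/-- A Poincaré inequality for the difference of two values. -/
lemma sq_sub_le_of_expansion (hsymm : ∀ u v, c u v = c v u) (hc : ∀ u v, 0 ≤ c u v)
    {κ D : ℝ} (hκ : 0 < κ)
    (hcut : ∀ S : Finset V, 2 * S.card ≤ Fintype.card V → κ * S.card ≤ cut c S)
    (hD : ∀ u, ∑ v, c u v ≤ D) (f : V → ℝ) {x y : V} (hxy : x ≠ y) :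
    (f x - f y) ^ 2 ≤ 2 * D / κ ^ 2 * ∑ u, ∑ v, c u v * (f u - f v) ^ 2 := by
  have : Nonempty V := ⟨x⟩
  -- Around a median, the positive and negative parts of `f - m` each live on at most half of the
  -- vertices, where the expansion hypothesis applies.
  obtain ⟨m, hm1, hm2⟩ := exists_median f
  have hcut' : ∀ S : Finset V, S.card ≤ Fintype.card V / 2 → κ * S.card ≤ cut c S :=
    fun S hS => hcut S (by omega)
  have hD0 : 0 ≤ D := (Finset.sum_nonneg fun w _ => hc x w).trans (hD x)
  have h1 := sum_sq_le_of_support hsymm hc hκ hcut' hD (fun v => max (f v - m) 0)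
    (fun v => le_max_right _ _)
    (by simp only [lt_max_iff, sub_pos, lt_self_iff_false, or_false]; omega)
  have h2 := sum_sq_le_of_support hsymm hc hκ hcut' hD (fun v => max (m - f v) 0)
    (fun v => le_max_right _ _)
    (by simp only [lt_max_iff, sub_pos, lt_self_iff_false, or_false]; omega)
  have hsq : ∀ a : ℝ, max (a - m) 0 ^ 2 + max (m - a) 0 ^ 2 = (a - m) ^ 2 := by
    intro a
    rcases le_total a m with h | h
    · rw [max_eq_right (by linarith), max_eq_left (by linarith)]; ring
    · rw [max_eq_left (by linarith), max_eq_right (by linarith)]; ring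
  have hdiff : ∀ a b : ℝ, (max (a - m) 0 - max (b - m) 0) ^ 2 +
      (max (m - a) 0 - max (m - b) 0) ^ 2 ≤ (a - b) ^ 2 := by
    intro a b
    rcases le_total a m with h | h <;> rcases le_total b m with h' | h'
    · rw [max_eq_right (by linarith), max_eq_right (by linarith), max_eq_left (by linarith),
        max_eq_left (by linarith)]; nlinarith
    · rw [max_eq_right (by linarith), max_eq_left (by linarith), max_eq_left (by linarith),
        max_eq_right (by linarith)]; nlinarith
    · rw [max_eq_left (by linarith), max_eq_right (by linarith), max_eq_right (by linarith),
        max_eq_left (by linarith)]; nlinarith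
    · rw [max_eq_left (by linarith), max_eq_left (by linarith), max_eq_right (by linarith),
        max_eq_right (by linarith)]; nlinarith
  have hE : ∑ u, ∑ v, c u v * (max (f u - m) 0 - max (f v - m) 0) ^ 2 +
      ∑ u, ∑ v, c u v * (max (m - f u) 0 - max (m - f v) 0) ^ 2 ≤
      ∑ u, ∑ v, c u v * (f u - f v) ^ 2 := by
    rw [← Finset.sum_add_distrib]
    refine Finset.sum_le_sum fun u _ => ?_
    rw [← Finset.sum_add_distrib]
    refine Finset.sum_le_sum fun v _ => ?_
    rw [← mul_add]
    exact mul_le_mul_of_nonneg_left (hdiff _ _) (hc u v)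
  have hA : ∑ v, (f v - m) ^ 2 = ∑ v, max (f v - m) 0 ^ 2 + ∑ v, max (m - f v) 0 ^ 2 := by
    rw [← Finset.sum_add_distrib]
    exact Finset.sum_congr rfl fun v _ => (hsq _).symm
  have hxy2 : (f x - m) ^ 2 + (f y - m) ^ 2 ≤ ∑ v, (f v - m) ^ 2 := by
    rw [← Finset.sum_pair (f := fun v => (f v - m) ^ 2) hxy]
    exact Finset.sum_le_univ_sum_of_nonneg fun v => sq_nonneg _
  rw [div_mul_eq_mul_div, le_div_iff₀ (by positivity)]
  have h3 := mul_le_mul_of_nonneg_left hE hD0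
  have h4 : (f x - f y) ^ 2 ≤ 2 * ∑ v, (f v - m) ^ 2 := by
    nlinarith [sq_nonneg (f x - m + (f y - m))]
  have h5 := mul_le_mul_of_nonneg_right h4 (sq_nonneg κ)
  rw [hA] at h5
  linarith

end Cheeger

/-! ### The overlap in terms of edge marginals -/

/-- The conductances of an environment. -/
def conductance {n : ℕ} (β : ℝ) (ω : Env n) (e : Edge n) : ℝ := Real.exp (-β * ω e)

lemma conductance_pos {n : ℕ} (β : ℝ) (ω : Env n) (e : Edge n) : 0 < conductance β ω e :=
  Real.exp_pos _

/-- The probability that the random spanning tree contains the edge `e`. -/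
def marginal {n : ℕ} (c : Edge n → ℝ) (e : Edge n) : ℝ := treesThrough c e / treesTotal c

/-- Write `|T ∩ T'|` as a sum of products of indicators over the edges; the two samples are
independent given `ω`. -/
lemma overlap_eq_sum_marginal_sq {n : ℕ} (β : ℝ) (ω : Env n) :
    overlap β ω = ∑ e, marginal (conductance β ω) e ^ 2 := by
  have hP : ∀ T : Finset (Edge n), treeProb β ω T =
      prodWeight (conductance β ω) T / treesTotal (conductance β ω) := fun T => rfl
  have hm : ∀ e, marginal (conductance β ω) e =
      ∑ T ∈ spanningTrees n, if e ∈ T then treeProb β ω T else 0 := by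
    intro e
    simp only [hP]
    rw [marginal, treesThrough, Finset.sum_div, Finset.sum_filter]
  have hcard : ∀ T T' : Finset (Edge n), ((T ∩ T').card : ℝ) =
      ∑ e, if e ∈ T then (if e ∈ T' then (1 : ℝ) else 0) else 0 := by
    intro T T'
    rw [Finset.card_eq_sum_ones, Nat.cast_sum]
    simp only [Nat.cast_one, ← ite_and, ← Finset.mem_inter]
    rw [← Finset.sum_filter]
    exact Finset.sum_congr (by ext; simp) fun _ _ => rfl
  simp only [hm, sq, Finset.sum_mul_sum]
  rw [overlap]
  refine Eq.trans ?_ Finset.sum_comm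
  refine Finset.sum_congr rfl fun T _ => ?_
  refine Eq.trans ?_ Finset.sum_comm
  refine Finset.sum_congr rfl fun T' _ => ?_
  rw [hcard, Finset.sum_mul, Finset.sum_mul]
  refine Finset.sum_congr rfl fun e _ => ?_
  split_ifs <;> ring

section

variable {n : ℕ} {c : Edge n → ℝ}

lemma marginal_nonneg (hc : ∀ e, 0 < c e) (e : Edge n) : 0 ≤ marginal c e :=
  div_nonneg (treesThrough_nonneg hc e) (Finset.sum_nonneg fun T _ => (prodWeight_pos hc T).le)

lemma marginal_le_one (hc : ∀ e, 0 < c e) (e : Edge n) : marginal c e ≤ 1 := by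
  refine div_le_one_of_le₀ ?_ (Finset.sum_nonneg fun T _ => (prodWeight_pos hc T).le)
  exact Finset.sum_le_sum_of_subset_of_nonneg (Finset.filter_subset _ _)
    fun T _ _ => (prodWeight_pos hc T).le

lemma sum_marginal (hc : ∀ e, 0 < c e) (hn : 0 < n) : ∑ e, marginal c e = n - 1 := by
  have hZ := treesTotal_pos hc hn
  simp only [marginal]
  rw [← Finset.sum_div, div_eq_iff hZ.ne']
  simp only [treesThrough, Finset.sum_filter]
  rw [Finset.sum_comm, treesTotal, Finset.mul_sum]
  refine Finset.sum_congr rfl fun T hT => ?_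
  have h := (mem_spanningTrees.1 hT).2
  rw [← Finset.sum_filter, Finset.sum_const, nsmul_eq_mul]
  congr 1
  rw [eq_sub_iff_add_eq]
  simp only [Finset.filter_univ_mem]
  exact_mod_cast h

lemma sum_marginal_le (hc : ∀ e, 0 < c e) : ∑ e, marginal c e ≤ n := by
  rcases n.eq_zero_or_pos with rfl | hn
  · rw [Finset.sum_eq_zero]
    · simp
    · intro e
      obtain ⟨u, -⟩ := exists_eq_mkEdge e
      exact u.elim0
  · rw [sum_marginal hc hn]; linarith

lemma overlap_le (β : ℝ) (ω : Env n) : overlap β ω ≤ n := by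
  rw [overlap_eq_sum_marginal_sq]
  refine le_trans (Finset.sum_le_sum fun e _ => ?_) (sum_marginal_le (conductance_pos β ω))
  have h0 := marginal_nonneg (conductance_pos β ω) e
  have h1 := marginal_le_one (conductance_pos β ω) e
  nlinarith

/-- The degree bound for the marginal of an edge. -/
lemma four_mul_le_mul_marginal (hc : ∀ e, 0 < c e) (hn : 0 < n) {x y : Fin n} (h : x ≠ y) :
    4 * c (mkEdge x y h) ≤ (∑ v, cond c x v + ∑ v, cond c y v + 2 * c (mkEdge x y h)) *
      marginal c (mkEdge x y h) := by
  have hxx : ∀ w, cond c w w = 0 := fun w => by simp [cond]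
  have hcxy : cond c x y = c (mkEdge x y h) := by simp [cond, h]
  -- The test function jumps by 2 across `xy`, so this edge counts 4 times; the two degrees account
  -- for 2 of these, and `2 * cond c x y` for the rest.
  have hE : energy c (fun u => (if u = x then (1 : ℝ) else 0) - (if u = y then 1 else 0)) =
      2 * (∑ v, cond c x v + ∑ v, cond c y v + 2 * cond c x y) := by
    have hpt : ∀ u v, cond c u v * ((if u = x then (1 : ℝ) else 0) - (if u = y then 1 else 0) -
        ((if v = x then (1 : ℝ) else 0) - (if v = y then 1 else 0))) ^ 2 =
        (if u = x then cond c x v else 0) + (if u = y then cond c y v else 0) +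
        (if v = x then cond c x u else 0) + (if v = y then cond c y u else 0) +
        (if u = x then (if v = y then 2 * cond c x y else 0) else 0) +
        (if v = x then (if u = y then 2 * cond c x y else 0) else 0) := by
      intro u v
      by_cases h1 : u = x
      · subst h1
        by_cases h3 : v = u
        · subst h3; simp [h, hxx]
        by_cases h4 : v = y
        · subst h4; simp [h, h.symm, cond_comm c v u]; ring
        simp [h, h3, h4]
      by_cases h2 : u = y
      · subst h2
        by_cases h3 : v = x
        · subst h3; simp [h, h.symm, cond_comm c v u]; ring
        by_cases h4 : v = u
        · subst h4; simp [h.symm, hxx]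
        simp [h.symm, h3, h4]
      by_cases h3 : v = x
      · subst h3; simp [h1, h2, h, cond_comm c v u]
      by_cases h4 : v = y
      · subst h4; simp [h1, h2, h3, cond_comm c v u]
      simp [h1, h2, h3, h4]
    rw [energy]
    simp only [hpt, Finset.sum_add_distrib]
    simp
    ring
  have key := mul_sq_le_energy_mul hc hn x y h
    (fun u => (if u = x then (1 : ℝ) else 0) - (if u = y then 1 else 0))
  rw [hE, hcxy] at key
  simp only [h, h.symm, if_true, if_false] at key
  have hZ := treesTotal_pos hc hn
  rw [marginal, mul_div_assoc', le_div_iff₀ hZ]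
  linarith

/-- The expansion bound for the marginal of an edge. -/
lemma marginal_le_of_expansion (hc : ∀ e, 0 < c e) (hn : 0 < n) {κ D : ℝ} (hκ : 0 < κ)
    (hcut : ∀ S : Finset (Fin n), 2 * S.card ≤ n → κ * S.card ≤ cut (cond c) S)
    (hD : ∀ u, ∑ v, cond c u v ≤ D) (e : Edge n) :
    marginal c e ≤ 4 * D / κ ^ 2 * c e := by
  obtain ⟨x, y, h, rfl⟩ := exists_eq_mkEdge e
  have := treesThrough_le hc x y h (fun f => sq_sub_le_of_expansion (cond_comm c) (cond_nonneg hc)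
    hκ (by simpa using hcut) hD f h)
  rw [marginal, div_le_iff₀ (treesTotal_pos hc hn)]
  refine this.trans_eq ?_
  ring

/-- The sum of the squared marginals when the conductances are typical for i.i.d. variables with
mean `q` and second moment `q₂`. -/
lemma sum_marginal_sq_bounds (hc : ∀ e, 0 < c e) (hc1 : ∀ e, c e ≤ 1) (hn : 2 ≤ n)
    {q q₂ ε : ℝ} (hq : 0 < q) (hq₂ : 0 < q₂) (hε : 0 < ε) (hε1 : ε ≤ 1) (hεn : 1 ≤ ε * n)
    (hεq : 1 ≤ ε * (n * q))
    (hcut : ∀ S : Finset (Fin n), 2 * S.card ≤ n → n * q / 4 * S.card ≤ cut (cond c) S)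
    (hdeg : ∀ u, ∑ v, cond c u v ≤ (1 + ε) * (n * q))
    (hsum : (1 - ε) * (n * (n - 1) / 2 * q) ≤ ∑ e, c e)
    (hsq : (1 - ε) * (n * (n - 1) / 2 * q₂) ≤ ∑ e, c e ^ 2)
    (hsq' : ∑ e, c e ^ 2 ≤ (1 + ε) * (n * (n - 1) / 2 * q₂)) :
    (1 - 6 * ε) * (2 * q₂ / q ^ 2) ≤ ∑ e, marginal c e ^ 2 ∧
      ∑ e, marginal c e ^ 2 ≤ (1 + ε) * (2 * q₂ / q ^ 2) + 520 * ε / q := by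
  have hn0 : 0 < n := by omega
  have hnR : (2 : ℝ) ≤ n := by exact_mod_cast hn
  have hnq : 0 < n * q := by positivity
  -- The slope given by the degree bound. The extra `2 * c e ≤ 2` is absorbed by `1 ≤ ε * (n * q)`,
  -- turning `1 + ε` into `1 + 2 * ε`.
  set l : ℝ := 2 / ((1 + 2 * ε) * (n * q)) with hl
  have hl0 : 0 < l := by positivity
  have hlow : ∀ e, l * c e ≤ marginal c e := by
    intro e
    obtain ⟨x, y, h, rfl⟩ := exists_eq_mkEdge e
    have h1 := four_mul_le_mul_marginal hc hn0 h
    have h2 : ∑ v, cond c x v + ∑ v, cond c y v + 2 * c (mkEdge x y h) ≤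
        2 * ((1 + 2 * ε) * (n * q)) := by
      linarith [hdeg x, hdeg y, hc1 (mkEdge x y h)]
    have h3 := mul_le_mul_of_nonneg_right h2 (marginal_nonneg hc (mkEdge x y h))
    rw [hl, div_mul_eq_mul_div, div_le_iff₀ (by positivity)]
    linarith
  have hup : ∀ e, marginal c e ≤ 128 / (n * q) := by
    intro e
    have h1 := marginal_le_of_expansion hc hn0 (by positivity) hcut hdeg e
    refine h1.trans ?_
    have h2 : 4 * ((1 + ε) * (n * q)) / (n * q / 4) ^ 2 = 64 * (1 + ε) / (n * q) := by
      field_simp; norm_num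
    rw [h2]
    calc _ ≤ 64 * (1 + ε) / (n * q) * 1 := by gcongr; exact hc1 e
      _ ≤ _ := by rw [mul_one]; gcongr; linarith
  have hl1 : l ≤ 2 / (n * q) := by
    exact div_le_div_of_nonneg_left (by norm_num) hnq (by nlinarith)
  -- The marginals sum to `n - 1`, and the lower bounds already sum to at least `(1 - 3 * ε) * (n -
  -- 1)`.
  have hr : ∑ e, (marginal c e - l * c e) ≤ 4 * ε * n := by
    rw [Finset.sum_sub_distrib, sum_marginal hc hn0, ← Finset.mul_sum]
    have h1 : l * ((1 - ε) * (n * (n - 1) / 2 * q)) ≤ l * ∑ e, c e := by gcongr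
    have h2 : l * ((1 - ε) * (n * (n - 1) / 2 * q)) = (1 - ε) / (1 + 2 * ε) * (n - 1) := by
      rw [hl]; field_simp
    have h3 : 1 - 3 * ε ≤ (1 - ε) / (1 + 2 * ε) := by
      rw [le_div_iff₀ (by positivity)]; nlinarith
    have h4 := mul_le_mul_of_nonneg_right h3 (show (0 : ℝ) ≤ n - 1 by linarith)
    nlinarith
  -- In the remainder the first factors are nonnegative with sum at most `4 * ε * n`, and the second
  -- factors are at most `(128 + 2) / (n * q)`; this produces `520 * ε / q`.
  have hsplit : ∑ e, marginal c e ^ 2 = l ^ 2 * ∑ e, c e ^ 2 +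
      ∑ e, (marginal c e - l * c e) * (marginal c e + l * c e) := by
    rw [Finset.mul_sum, ← Finset.sum_add_distrib]
    exact Finset.sum_congr rfl fun e _ => by ring
  have hn1 : (0 : ℝ) ≤ n - 1 := by linarith
  constructor
  · have h1 : 0 ≤ ∑ e, (marginal c e - l * c e) * (marginal c e + l * c e) :=
      Finset.sum_nonneg fun e _ => mul_nonneg (by linarith [hlow e])
        (add_nonneg (marginal_nonneg hc e) (mul_nonneg hl0.le (hc e).le))
    have h2 : l ^ 2 * ((1 - ε) * (n * (n - 1) / 2 * q₂)) ≤ l ^ 2 * ∑ e, c e ^ 2 := by gcongr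
    have h3 : l ^ 2 * ((1 - ε) * (n * (n - 1) / 2 * q₂)) =
        (1 - ε) / (1 + 2 * ε) ^ 2 * ((n - 1) / n) * (2 * q₂ / q ^ 2) := by
      rw [hl]; field_simp
    have h4 : 1 - 5 * ε ≤ (1 - ε) / (1 + 2 * ε) ^ 2 := by
      rw [le_div_iff₀ (by positivity)]
      nlinarith [mul_pos hε hε, mul_pos (mul_pos hε hε) hε]
    have h5 : 1 - ε ≤ (n - 1) / (n : ℝ) := by
      rw [le_div_iff₀ (by positivity)]; linarith
    have h6 : 1 - 6 * ε ≤ (1 - ε) / (1 + 2 * ε) ^ 2 * ((n - 1) / n) := by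
      have h7 : 0 ≤ (1 - ε) / (1 + 2 * ε) ^ 2 := div_nonneg (by linarith) (by positivity)
      have h8 : (1 - ε) / (1 + 2 * ε) ^ 2 ≤ 1 := by
        rw [div_le_one (by positivity)]; nlinarith
      nlinarith
    have h9 : 0 ≤ 2 * q₂ / q ^ 2 := by positivity
    have h10 := mul_le_mul_of_nonneg_right h6 h9
    linarith
  · have h1 : ∑ e, (marginal c e - l * c e) * (marginal c e + l * c e) ≤ 520 * ε / q := by
      calc _ ≤ ∑ e, (marginal c e - l * c e) * (130 / (n * q)) := by
            refine Finset.sum_le_sum fun e _ => mul_le_mul_of_nonneg_left ?_ (by linarith [hlow e])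
            have : l * c e ≤ 2 / (n * q) :=
              (mul_le_of_le_one_right hl0.le (hc1 e)).trans hl1
            calc _ ≤ 128 / (n * q) + 2 / (n * q) := add_le_add (hup e) this
              _ = _ := by rw [← add_div]; norm_num
        _ = (∑ e, (marginal c e - l * c e)) * (130 / (n * q)) := by rw [Finset.sum_mul]
        _ ≤ 4 * ε * n * (130 / (n * q)) := by gcongr
        _ = _ := by field_simp; norm_num
    have h2 : l ^ 2 * ∑ e, c e ^ 2 ≤
        (2 / (n * q)) ^ 2 * ((1 + ε) * (n * (n - 1) / 2 * q₂)) := by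
      gcongr
    have h3 : (2 / (n * q)) ^ 2 * ((1 + ε) * (n * (n - 1) / 2 * q₂)) =
        (1 + ε) * ((n - 1) / n * (2 * q₂ / q ^ 2)) := by
      field_simp
    have h4 : (n - 1) / (n : ℝ) * (2 * q₂ / q ^ 2) ≤ 2 * q₂ / q ^ 2 := by
      refine mul_le_of_le_one_left (by positivity) ?_
      rw [div_le_one (by positivity)]; linarith
    have h5 := mul_le_mul_of_nonneg_left h4 (show 0 ≤ 1 + ε by linarith)
    linarith

end

/-! ### Concentration of sums over edges -/

/-- The uniform law on `[0, 1]`. -/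
def unifLaw : Measure ℝ := (volume : Measure ℝ).restrict (Set.Icc 0 1)

instance : IsProbabilityMeasure unifLaw := ⟨by simp [unifLaw]⟩

lemma envLaw_eq (n : ℕ) : envLaw n = Measure.pi fun _ : Edge n => unifLaw := rfl

lemma ae_unifLaw_mem : ∀ᵐ x ∂unifLaw, x ∈ Set.Icc (0 : ℝ) 1 :=
  ae_restrict_mem measurableSet_Icc

lemma ae_envLaw_mem (n : ℕ) : ∀ᵐ ω ∂envLaw n, ∀ e, ω e ∈ Set.Icc (0 : ℝ) 1 := by
  rw [ae_all_iff]
  intro e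
  exact (Measure.quasiMeasurePreserving_eval (fun _ : Edge n => unifLaw) e).ae ae_unifLaw_mem

lemma exp_mul_le_of_mem {x : ℝ} (hx : x ∈ Set.Icc (0 : ℝ) 1) (t : ℝ) :
    Real.exp (t * x) ≤ 1 + (Real.exp t - 1) * x := by
  have := convexOn_exp.2 (Set.mem_univ 0) (Set.mem_univ t) (sub_nonneg.2 hx.2) hx.1 (by ring)
  simp only [smul_eq_mul, mul_zero, zero_add, Real.exp_zero, mul_one] at this
  rw [mul_comm t x]
  linarith

section Chernoff

variable {n : ℕ} {g : ℝ → ℝ}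

/-- By convexity of `exp`, a `[0, 1]`-valued variable has a moment generating function at most that
of a Bernoulli, hence of a Poisson, variable with the same mean. The exponent is thus proportional
to the mean, which matters since `q` may tend to 0. -/
lemma mgf_unifLaw_le (hg : Measurable g)
    (hg01 : ∀ x ∈ Set.Icc (0 : ℝ) 1, g x ∈ Set.Icc (0 : ℝ) 1) (t : ℝ) :
    ∫ x, Real.exp (t * g x) ∂unifLaw ≤ Real.exp ((Real.exp t - 1) * ∫ x, g x ∂unifLaw) := by
  have hae : ∀ᵐ x ∂unifLaw, g x ∈ Set.Icc (0 : ℝ) 1 := by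
    filter_upwards [ae_unifLaw_mem] with x hx using hg01 x hx
  have hint : Integrable g unifLaw := Integrable.of_mem_Icc 0 1 hg.aemeasurable hae
  calc _ ≤ ∫ x, (1 + (Real.exp t - 1) * g x) ∂unifLaw := by
        refine integral_mono_ae
          (ProbabilityTheory.integrable_exp_mul_of_mem_Icc hg.aemeasurable hae)
          ((integrable_const _).add (hint.const_mul _)) ?_
        filter_upwards [hae] with x hx using exp_mul_le_of_mem hx t
    _ = (Real.exp t - 1) * ∫ x, g x ∂unifLaw + 1 := by
        rw [integral_add (integrable_const _) (hint.const_mul _), integral_const_mul]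
        simp [add_comm]
    _ ≤ _ := Real.add_one_le_exp _

lemma integrable_exp_sum (hg : Measurable g)
    (hg01 : ∀ x ∈ Set.Icc (0 : ℝ) 1, g x ∈ Set.Icc (0 : ℝ) 1) (F : Finset (Edge n)) (t : ℝ) :
    Integrable (fun ω => Real.exp (t * (∑ e ∈ F, g (ω e)))) (envLaw n) := by
  refine ProbabilityTheory.integrable_exp_mul_of_mem_Icc (a := 0) (b := F.card)
    (Finset.measurable_sum _ fun e _ => hg.comp (measurable_pi_apply e)).aemeasurable ?_
  filter_upwards [ae_envLaw_mem n] with ω hω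
  refine ⟨Finset.sum_nonneg fun e _ => (hg01 _ (hω e)).1, ?_⟩
  calc _ ≤ ∑ e ∈ F, (1 : ℝ) := Finset.sum_le_sum fun e _ => (hg01 _ (hω e)).2
    _ = _ := by simp

lemma mgf_sum_le (hg : Measurable g)
    (hg01 : ∀ x ∈ Set.Icc (0 : ℝ) 1, g x ∈ Set.Icc (0 : ℝ) 1) (F : Finset (Edge n)) {t : ℝ}
    (ht : |t| ≤ 1) :
    ProbabilityTheory.mgf (fun ω : Env n => ∑ e ∈ F, g (ω e)) (envLaw n) t ≤
      Real.exp ((t + t ^ 2) * (F.card * ∫ x, g x ∂unifLaw)) := by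
  have hind : ProbabilityTheory.iIndepFun (fun (e : Edge n) (ω : Env n) => g (ω e)) (envLaw n) := by
    rw [envLaw_eq]
    exact ProbabilityTheory.iIndepFun_pi (X := fun _ => g) fun _ => hg.aemeasurable
  have hsum : (fun ω : Env n => ∑ e ∈ F, g (ω e)) = ∑ e ∈ F, fun ω : Env n => g (ω e) := by
    ext ω; simp
  rw [hsum, hind.mgf_sum (fun e => by fun_prop)]
  have hq : 0 ≤ ∫ x, g x ∂unifLaw := integral_nonneg_of_ae <| by
    filter_upwards [ae_unifLaw_mem] with x hx using (hg01 x hx).1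
  -- Valid for both signs of `t`, so one estimate serves both tails.
  have hexp : Real.exp t - 1 ≤ t + t ^ 2 := by
    have := (abs_le.1 (Real.abs_exp_sub_one_sub_id_le ht)).2
    linarith
  calc _ ≤ ∏ e ∈ F, Real.exp ((t + t ^ 2) * ∫ x, g x ∂unifLaw) := by
        refine Finset.prod_le_prod (fun e _ => ProbabilityTheory.mgf_nonneg) fun e _ => ?_
        have h1 : ProbabilityTheory.mgf (fun ω : Env n => g (ω e)) (envLaw n) t =
            ∫ x, Real.exp (t * g x) ∂unifLaw := by
          rw [ProbabilityTheory.mgf, envLaw_eq]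
          exact integral_comp_eval (μ := fun _ : Edge n => unifLaw) (i := e)
            (f := fun x => Real.exp (t * g x)) (by fun_prop)
        rw [h1]
        refine (mgf_unifLaw_le hg hg01 t).trans (Real.exp_le_exp.2 ?_)
        exact mul_le_mul_of_nonneg_right hexp hq
    _ = _ := by
        rw [Finset.prod_const, ← Real.exp_nat_mul]
        congr 1; ring

/-- Chernoff's bound for the upper tail. -/
lemma measure_ge_sum_le (hg : Measurable g)
    (hg01 : ∀ x ∈ Set.Icc (0 : ℝ) 1, g x ∈ Set.Icc (0 : ℝ) 1) (F : Finset (Edge n)) {ε : ℝ}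
    (hε : 0 ≤ ε) (hε1 : ε ≤ 1) :
    (envLaw n).real {ω | (1 + ε) * (F.card * ∫ x, g x ∂unifLaw) ≤ ∑ e ∈ F, g (ω e)} ≤
      Real.exp (-(ε ^ 2 / 4 * (F.card * ∫ x, g x ∂unifLaw))) := by
  -- The choice `t = ε / 2` minimises `t + t ^ 2 - t * (1 + ε)`, with value `-ε ^ 2 / 4`.
  refine (ProbabilityTheory.measure_ge_le_exp_mul_mgf _ (by positivity : 0 ≤ ε / 2)
    (integrable_exp_sum hg hg01 F _)).trans ?_
  refine (mul_le_mul_of_nonneg_left (mgf_sum_le hg hg01 F (t := ε / 2) ?_)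
    (Real.exp_pos _).le).trans_eq ?_
  · rw [abs_of_nonneg (by positivity)]; linarith
  · rw [← Real.exp_add]
    congr 1; ring

/-- Chernoff's bound for the lower tail. -/
lemma measure_sum_le_le (hg : Measurable g)
    (hg01 : ∀ x ∈ Set.Icc (0 : ℝ) 1, g x ∈ Set.Icc (0 : ℝ) 1) (F : Finset (Edge n)) {ε : ℝ}
    (hε : 0 ≤ ε) (hε1 : ε ≤ 1) :
    (envLaw n).real {ω | ∑ e ∈ F, g (ω e) ≤ (1 - ε) * (F.card * ∫ x, g x ∂unifLaw)} ≤
      Real.exp (-(ε ^ 2 / 4 * (F.card * ∫ x, g x ∂unifLaw))) := by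
  refine (ProbabilityTheory.measure_le_le_exp_mul_mgf _ (by linarith : -(ε / 2) ≤ 0)
    (integrable_exp_sum hg hg01 F _)).trans ?_
  refine (mul_le_mul_of_nonneg_left (mgf_sum_le hg hg01 F (t := -(ε / 2)) ?_)
    (Real.exp_pos _).le).trans_eq ?_
  · rw [abs_neg, abs_of_nonneg (by positivity)]; linarith
  · rw [← Real.exp_add]
    congr 1; ring

end Chernoff

/-! ### Typical environments -/

/-- The edges between `S` and its complement. -/
def crossing {n : ℕ} (S : Finset (Fin n)) : Finset (Edge n) :=
  (S ×ˢ Sᶜ).attach.image fun p => mkEdge p.1.1 p.1.2 fun h => by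
    have := Finset.mem_product.1 p.2
    rw [Finset.mem_compl, ← h] at this
    exact this.2 this.1

/-- A crossing edge has exactly one endpoint in `S`, which fixes its orientation. -/
lemma crossing_injOn {n : ℕ} (S : Finset (Fin n)) : Function.Injective
    fun p : {p // p ∈ S ×ˢ Sᶜ} => mkEdge p.1.1 p.1.2 fun h => by
      have := Finset.mem_product.1 p.2
      rw [Finset.mem_compl, ← h] at this
      exact this.2 this.1 := by
  rintro ⟨⟨a, b⟩, hp⟩ ⟨⟨a', b'⟩, hp'⟩ h
  rw [mkEdge_eq_iff] at h
  simp only [Finset.mem_product, Finset.mem_compl] at hp hp'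
  rcases h with ⟨h1, h2⟩ | ⟨h1, h2⟩
  · simp only at h1 h2
    subst h1 h2; rfl
  · simp only at h1 h2
    subst h1 h2
    exact absurd hp.1 hp'.2

lemma card_crossing {n : ℕ} (S : Finset (Fin n)) : (crossing S).card = S.card * (n - S.card) := by
  rw [crossing, Finset.card_image_of_injective _ (crossing_injOn S), Finset.card_attach,
    Finset.card_product, Finset.card_compl, Fintype.card_fin]

lemma sum_crossing {n : ℕ} (c : Edge n → ℝ) (S : Finset (Fin n)) :
    ∑ e ∈ crossing S, c e = cut (cond c) S := by
  rw [crossing, Finset.sum_image (fun a _ b _ h => crossing_injOn S h), cut,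
    ← Finset.sum_product', ← Finset.sum_attach (S ×ˢ Sᶜ)]
  refine Finset.sum_congr rfl fun p _ => ?_
  have hne : p.1.1 ≠ p.1.2 := fun h => by
    have := Finset.mem_product.1 p.2
    rw [Finset.mem_compl, ← h] at this
    exact this.2 this.1
  simp [cond, hne]

lemma cut_singleton {n : ℕ} (c : Edge n → ℝ) (x : Fin n) :
    cut (cond c) {x} = ∑ v, cond c x v := by
  rw [cut, Finset.sum_singleton, ← Finset.sum_add_sum_compl {x}]
  simp [cond]

lemma card_edge (n : ℕ) : ((Finset.univ : Finset (Edge n)).card : ℝ) = n * (n - 1) / 2 := by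
  have h : (Finset.univ : Finset (Edge n)).card = n.choose 2 := by
    rw [Finset.card_univ]
    have := SimpleGraph.card_edgeFinset_top_eq_card_choose_two (V := Fin n)
    rw [Fintype.card_fin] at this
    rw [← this, ← SimpleGraph.edgeFinset_card]
  rw [h, Nat.cast_choose_two]

/-- The mean of `exp (-β x)` for a uniform random variable `x`. -/
def meanConductance (β : ℝ) : ℝ := ∫ x, Real.exp (-β * x) ∂unifLaw

lemma meanConductance_eq {β : ℝ} (hβ : β ≠ 0) :
    meanConductance β = (1 - Real.exp (-β)) / β := by
  rw [meanConductance, unifLaw, integral_Icc_eq_integral_Ioc,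
    ← intervalIntegral.integral_of_le zero_le_one,
    intervalIntegral.integral_comp_mul_left (fun x => Real.exp x) (neg_ne_zero.2 hβ), integral_exp,
    smul_eq_mul, mul_zero, mul_one, Real.exp_zero]
  field_simp
  ring

lemma meanConductance_two_mul (β : ℝ) :
    ∫ x, Real.exp (-β * x) ^ 2 ∂unifLaw = meanConductance (2 * β) := by
  rw [meanConductance]
  congr 1
  ext x
  rw [← Real.exp_nat_mul]
  congr 1; push_cast; ring

/-- Equivalent to `1 + β ≤ exp β`. It turns `β = o(n / log n)` into `n * meanConductance β ≫ log n`.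
-/
lemma one_div_le_meanConductance {β : ℝ} (hβ : 0 < β) : 1 / (1 + β) ≤ meanConductance β := by
  rw [meanConductance_eq hβ.ne', div_le_div_iff₀ (by positivity) hβ]
  have h1 := Real.add_one_le_exp β
  have h2 : Real.exp (-β) * Real.exp β = 1 := by rw [← Real.exp_add]; simp
  nlinarith [Real.exp_pos (-β)]

lemma meanConductance_pos {β : ℝ} (hβ : 0 < β) : 0 < meanConductance β :=
  lt_of_lt_of_le (by positivity) (one_div_le_meanConductance hβ)

lemma two_mul_meanConductance_two_mul {β : ℝ} (hβ : 0 < β) :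
    2 * meanConductance (2 * β) = (1 + Real.exp (-β)) * meanConductance β := by
  rw [meanConductance_eq hβ.ne', meanConductance_eq (by positivity)]
  have : Real.exp (-(2 * β)) = Real.exp (-β) ^ 2 := by
    rw [← Real.exp_nat_mul]; congr 1; push_cast; ring
  rw [this]
  field_simp
  ring

/-- The limiting overlap. -/
lemma limit_overlap_eq {β : ℝ} (hβ : 0 < β) :
    β * ((1 - Real.exp (-2 * β)) / (1 - Real.exp (-β)) ^ 2) =
      2 * meanConductance (2 * β) / meanConductance β ^ 2 := by
  have h : Real.exp (-β) < 1 := Real.exp_lt_one_iff.2 (by linarith)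
  have h' : 1 - Real.exp (-β) ≠ 0 := by linarith
  rw [meanConductance_eq hβ.ne', meanConductance_eq (by positivity), neg_mul]
  field_simp

/-- An environment whose conductances have typical cuts, degrees and moments. -/
structure IsTypical {n : ℕ} (β ε : ℝ) (ω : Env n) : Prop where
  nonneg : ∀ e, 0 ≤ ω e
  cut_ge : ∀ S : Finset (Fin n), 2 * S.card ≤ n →
    n * meanConductance β / 4 * S.card ≤ cut (cond (conductance β ω)) S
  degree_le : ∀ u, ∑ v, cond (conductance β ω) u v ≤ (1 + ε) * (n * meanConductance β)
  le_sum : (1 - ε) * (n * (n - 1) / 2 * meanConductance β) ≤ ∑ e, conductance β ω e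
  le_sum_sq : (1 - ε) * (n * (n - 1) / 2 * meanConductance (2 * β)) ≤
    ∑ e, conductance β ω e ^ 2
  sum_sq_le : ∑ e, conductance β ω e ^ 2 ≤
    (1 + ε) * (n * (n - 1) / 2 * meanConductance (2 * β))

lemma exp_neg_mul_mem {β : ℝ} (hβ : 0 < β) (x : ℝ) (hx : x ∈ Set.Icc (0 : ℝ) 1) :
    Real.exp (-β * x) ∈ Set.Icc (0 : ℝ) 1 :=
  ⟨(Real.exp_pos _).le, Real.exp_le_one_iff.2 (by nlinarith [hx.1])⟩

lemma exp_neg_mul_sq_mem {β : ℝ} (hβ : 0 < β) (x : ℝ) (hx : x ∈ Set.Icc (0 : ℝ) 1) :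
    Real.exp (-β * x) ^ 2 ∈ Set.Icc (0 : ℝ) 1 :=
  ⟨sq_nonneg _, pow_le_one₀ (exp_neg_mul_mem hβ x hx).1 (exp_neg_mul_mem hβ x hx).2⟩

/-- A union bound. The first term collects the cuts; the `n + 3` other events are the degrees, the
lower tail of the first moment and both tails of the second. -/
lemma measure_not_isTypical_le {n : ℕ} (hn : 2 ≤ n) {β ε : ℝ} (hβ : 0 < β) (hε : 0 < ε)
    (hε1 : ε ≤ 1) :
    (envLaw n).real {ω | ¬ IsTypical β ε ω} ≤
      (Real.exp (n * Real.exp (-(n * meanConductance β / 32))) - 1) +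
        (n + 3) * Real.exp (-(ε ^ 2 / 16 * (n * meanConductance β))) := by
  set q := meanConductance β with hq
  have hq0 : 0 < q := meanConductance_pos hβ
  set q₂ := meanConductance (2 * β) with hq₂
  have hq₂q : q / 2 ≤ q₂ := by
    have := two_mul_meanConductance_two_mul hβ
    nlinarith [mul_pos (Real.exp_pos (-β)) hq0]
  have hnR : (2 : ℝ) ≤ n := by exact_mod_cast hn
  have hm : Measurable fun x : ℝ => Real.exp (-β * x) := by fun_prop
  have hm2 : Measurable fun x : ℝ => Real.exp (-β * x) ^ 2 := by fun_prop
  set 𝒮 := Finset.univ.filter fun S : Finset (Fin n) => S.Nonempty ∧ 2 * S.card ≤ n with h𝒮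
  set N : Set (Env n) := {ω | ¬ ∀ e, ω e ∈ Set.Icc (0 : ℝ) 1} with hN
  -- A cut below half its mean `|S| (n - |S|) q`. As `n - |S| ≥ n / 2`, this leaves the constant `1
  -- / 4` of `cut_ge`, and the Chernoff exponent is at least `|S| n q / 32`.
  set A : Finset (Fin n) → Set (Env n) := fun S =>
    {ω | ∑ e ∈ crossing S, Real.exp (-β * ω e) ≤ (1 - 1 / 2) * ((crossing S).card * q)} with hA
  set B : Fin n → Set (Env n) := fun x =>
    {ω | (1 + ε) * ((crossing {x}).card * q) ≤ ∑ e ∈ crossing {x}, Real.exp (-β * ω e)} with hB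
  set C : Set (Env n) := {ω | ∑ e ∈ Finset.univ, Real.exp (-β * ω e) ≤
    (1 - ε) * ((Finset.univ : Finset (Edge n)).card * q)} with hC
  set D : Set (Env n) := {ω | ∑ e ∈ Finset.univ, Real.exp (-β * ω e) ^ 2 ≤
    (1 - ε) * ((Finset.univ : Finset (Edge n)).card * q₂)} with hD
  set D' : Set (Env n) := {ω | (1 + ε) * ((Finset.univ : Finset (Edge n)).card * q₂) ≤
    ∑ e ∈ Finset.univ, Real.exp (-β * ω e) ^ 2} with hD'
  have hsub : {ω | ¬ IsTypical β ε ω} ⊆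
      N ∪ (⋃ S ∈ 𝒮, A S) ∪ (⋃ x ∈ (Finset.univ : Finset (Fin n)), B x) ∪ C ∪ D ∪ D' := by
    intro ω hω
    by_contra hno
    simp only [Set.mem_union, not_or, Set.mem_iUnion, not_exists] at hno
    obtain ⟨⟨⟨⟨⟨h1, h2⟩, h3⟩, h4⟩, h5⟩, h6⟩ := hno
    simp only [hN, hA, hB, hC, hD, hD', Set.mem_ofPred_eq, not_not, not_le, card_edge]
      at h1 h2 h3 h4 h5 h6
    refine hω ⟨fun e => (h1 e).1, fun S hS => ?_, fun x => ?_, h4.le, h5.le, h6.le⟩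
    · rcases S.eq_empty_or_nonempty with rfl | hne
      · simp [cut]
      have h := h2 S (by simp [h𝒮, hne, hS])
      rw [show (fun e => Real.exp (-β * ω e)) = conductance β ω from rfl, sum_crossing,
        card_crossing, Nat.cast_mul, Nat.cast_sub (by omega)] at h
      refine le_trans ?_ h.le
      have hS' : 2 * (S.card : ℝ) ≤ n := by exact_mod_cast hS
      have : (0 : ℝ) ≤ S.card * q := by positivity
      nlinarith
    · have h := h3 x (Finset.mem_univ x)
      rw [show (fun e => Real.exp (-β * ω e)) = conductance β ω from rfl, sum_crossing,
        card_crossing, cut_singleton, Finset.card_singleton, one_mul,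
        Nat.cast_sub (by omega)] at h
      refine h.le.trans ?_
      have : 0 ≤ (1 + ε) * q := by positivity
      push_cast
      nlinarith
  set y := Real.exp (-(n * q / 32)) with hy
  set z := Real.exp (-(ε ^ 2 / 16 * (n * q))) with hz
  have bN : (envLaw n).real N = 0 := by
    rw [measureReal_eq_zero_iff]
    exact ae_envLaw_mem n
  have bA : (envLaw n).real (⋃ S ∈ 𝒮, A S) ≤ Real.exp (n * y) - 1 := by
    have hS : ∀ S ∈ 𝒮, (envLaw n).real (A S) ≤ y ^ S.card := by
      intro S hS
      have hS2 : 2 * S.card ≤ n := (Finset.mem_filter.1 hS).2.2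
      refine (measure_sum_le_le hm (exp_neg_mul_mem hβ) (crossing S) (ε := 1 / 2) (by norm_num)
        (by norm_num)).trans ?_
      rw [hy, ← Real.exp_nat_mul, Real.exp_le_exp, card_crossing, Nat.cast_mul,
        Nat.cast_sub (by omega), ← meanConductance, ← hq]
      have hS' : 2 * (S.card : ℝ) ≤ n := by exact_mod_cast hS2
      have : (0 : ℝ) ≤ S.card * q := by positivity
      nlinarith
    calc _ ≤ ∑ S ∈ 𝒮, (envLaw n).real (A S) := measureReal_biUnion_finset_le _ _
      _ ≤ ∑ S ∈ 𝒮, y ^ S.card := Finset.sum_le_sum hS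
      -- The decay in `|S|` beats the number of sets: over all subsets the sum is `(1 + y) ^ n`. The
      -- empty set, contributing 1, must be left out.
      _ ≤ ∑ S ∈ Finset.univ.erase (∅ : Finset (Fin n)), y ^ S.card := by
          refine Finset.sum_le_sum_of_subset_of_nonneg ?_ fun S _ _ =>
            pow_nonneg (Real.exp_pos _).le _
          intro S hS
          simp only [h𝒮, Finset.mem_filter, Finset.mem_univ, true_and] at hS
          simp [hS.1.ne_empty]
      _ = (y + 1) ^ n - 1 := by
          rw [Finset.sum_erase_eq_sub (Finset.mem_univ _), ← Fin.sum_pow_mul_eq_add_pow]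
          simp
      _ ≤ _ := by
          have := pow_le_pow_left₀ (by positivity) (Real.add_one_le_exp y) n
          rw [← Real.exp_nat_mul] at this
          linarith
  have hcard : (n : ℝ) / 2 ≤ (Finset.univ : Finset (Edge n)).card := by
    rw [card_edge]; nlinarith
  have bB : (envLaw n).real (⋃ x ∈ (Finset.univ : Finset (Fin n)), B x) ≤ n * z := by
    have hx : ∀ x, (envLaw n).real (B x) ≤ z := by
      intro x
      refine (measure_ge_sum_le hm (exp_neg_mul_mem hβ) (crossing {x}) hε.le hε1).trans ?_
      rw [hz, Real.exp_le_exp, card_crossing, Finset.card_singleton, one_mul,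
        Nat.cast_sub (by omega), ← meanConductance, ← hq]
      have : 0 ≤ ε ^ 2 * q := by positivity
      push_cast
      nlinarith
    calc _ ≤ ∑ x, (envLaw n).real (B x) := measureReal_biUnion_finset_le _ _
      _ ≤ ∑ x : Fin n, z := Finset.sum_le_sum fun x _ => hx x
      _ = _ := by simp
  have haux : ∀ p : ℝ, q / 2 ≤ p →
      Real.exp (-(ε ^ 2 / 4 * ((Finset.univ : Finset (Edge n)).card * p))) ≤ z := by
    intro p hp
    rw [hz, Real.exp_le_exp]
    have h1 : (n : ℝ) / 2 * (q / 2) ≤ (Finset.univ : Finset (Edge n)).card * p :=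
      mul_le_mul hcard hp (by positivity) (by positivity)
    have h2 := mul_le_mul_of_nonneg_left h1 (show 0 ≤ ε ^ 2 / 4 by positivity)
    linarith
  have bC : (envLaw n).real C ≤ z :=
    (measure_sum_le_le hm (exp_neg_mul_mem hβ) Finset.univ hε.le hε1).trans
      (haux q (by linarith))
  have bD : (envLaw n).real D ≤ z := by
    have := measure_sum_le_le (n := n) hm2 (exp_neg_mul_sq_mem hβ) Finset.univ hε.le hε1
    rw [meanConductance_two_mul] at this
    exact this.trans (haux q₂ hq₂q)
  have bD' : (envLaw n).real D' ≤ z := by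
    have := measure_ge_sum_le (n := n) hm2 (exp_neg_mul_sq_mem hβ) Finset.univ hε.le hε1
    rw [meanConductance_two_mul] at this
    exact this.trans (haux q₂ hq₂q)
  have u0 := measureReal_mono (μ := envLaw n) hsub
  have u1 := measureReal_union_le (μ := envLaw n) (N ∪ (⋃ S ∈ 𝒮, A S) ∪
    (⋃ x ∈ (Finset.univ : Finset (Fin n)), B x) ∪ C ∪ D) D'
  have u2 := measureReal_union_le (μ := envLaw n) (N ∪ (⋃ S ∈ 𝒮, A S) ∪
    (⋃ x ∈ (Finset.univ : Finset (Fin n)), B x) ∪ C) D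
  have u3 := measureReal_union_le (μ := envLaw n) (N ∪ (⋃ S ∈ 𝒮, A S) ∪
    (⋃ x ∈ (Finset.univ : Finset (Fin n)), B x)) C
  have u4 := measureReal_union_le (μ := envLaw n) (N ∪ (⋃ S ∈ 𝒮, A S))
    (⋃ x ∈ (Finset.univ : Finset (Fin n)), B x)
  have u5 := measureReal_union_le (μ := envLaw n) N (⋃ S ∈ 𝒮, A S)
  linarith

/-- The additive error `520 * ε / q` becomes relative because the limit `2 q₂ / q²` is at least `1 /
q`. -/
lemma IsTypical.abs_overlap_sub_le {n : ℕ} {β ε : ℝ} {ω : Env n} (h : IsTypical β ε ω)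
    (hn : 2 ≤ n) (hβ : 0 < β) (hε : 0 < ε) (hε1 : ε ≤ 1) (hεn : 1 ≤ ε * n)
    (hεq : 1 ≤ ε * (n * meanConductance β)) :
    |overlap β ω - β * ((1 - Real.exp (-2 * β)) / (1 - Real.exp (-β)) ^ 2)| ≤
      600 * ε * (β * ((1 - Real.exp (-2 * β)) / (1 - Real.exp (-β)) ^ 2)) := by
  have hq := meanConductance_pos hβ
  have hq₂ : 0 < meanConductance (2 * β) := meanConductance_pos (by positivity)
  have hb := sum_marginal_sq_bounds (conductance_pos β ω)
    (fun e => Real.exp_le_one_iff.2 (by nlinarith [h.nonneg e])) hn hq hq₂ hε hε1 hεn hεq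
    h.cut_ge h.degree_le h.le_sum h.le_sum_sq h.sum_sq_le
  rw [← overlap_eq_sum_marginal_sq] at hb
  rw [limit_overlap_eq hβ]
  set m := 2 * meanConductance (2 * β) / meanConductance β ^ 2 with hm
  have hm1 : 1 / meanConductance β ≤ m := by
    rw [hm, two_mul_meanConductance_two_mul hβ, div_le_div_iff₀ hq (by positivity)]
    nlinarith [mul_pos (Real.exp_pos (-β)) (mul_pos hq hq)]
  have hm0 : 0 < m := lt_of_lt_of_le (by positivity) hm1
  have h1 : 520 * ε / meanConductance β ≤ 520 * ε * m := by
    rw [div_eq_mul_one_div]; gcongr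
  have h2 := mul_pos hε hm0
  rw [abs_le]
  constructor <;> nlinarith [hb.1, hb.2]

/-! ### Convergence in probability -/

/-- A family of random variables that is asymptotically nonpositive in probability is bounded by a
deterministic null sequence with high probability. -/
lemma exists_tendsto_zero_withHighProbability {X : ∀ n : ℕ, Env n → ℝ}
    (h : ∀ ε : ℝ, 0 < ε → Tendsto (fun n => (envLaw n).real {ω | ε < X n ω}) atTop (𝓝 0)) :
    ∃ δ : ℕ → ℝ, Tendsto δ atTop (𝓝 0) ∧ WithHighProbability fun n => {ω | X n ω ≤ δ n} := by
  -- The infimum of this set is the Ky Fan distance from the positive part of `X n` to 0. Adding `1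
  -- / (n + 1)` to it guarantees a member of the set below `δ n`.
  set S : ℕ → Set ℝ := fun n => {ε | 0 ≤ ε ∧ (envLaw n).real {ω | ε < X n ω} ≤ ε} with hS
  have hbdd : ∀ n, BddBelow (S n) := fun n => ⟨0, fun ε hε => hε.1⟩
  have hne : ∀ n, (S n).Nonempty := fun n => ⟨1, zero_le_one, measureReal_le_one⟩
  have hinf0 : ∀ n, 0 ≤ sInf (S n) := fun n => Real.sInf_nonneg fun ε hε => hε.1
  have hinf : Tendsto (fun n => sInf (S n)) atTop (𝓝 0) := by
    rw [Metric.tendsto_atTop']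
    intro ε hε
    have h1 : ∀ᶠ n in atTop, (envLaw n).real {ω | ε / 2 < X n ω} < ε / 2 :=
      (h (ε / 2) (by positivity)).eventually_lt_const (by positivity)
    obtain ⟨n₀, hn₀⟩ := eventually_atTop.1 h1
    refine ⟨n₀, fun n hn => ?_⟩
    rw [Real.dist_eq, sub_zero, abs_of_nonneg (hinf0 n)]
    have : sInf (S n) ≤ ε / 2 := csInf_le (hbdd n) ⟨by positivity, (hn₀ n hn.le).le⟩
    linarith
  have hδ : Tendsto (fun n : ℕ => sInf (S n) + 1 / ((n : ℝ) + 1)) atTop (𝓝 0) := by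
    simpa using hinf.add tendsto_one_div_add_atTop_nhds_zero_nat
  refine ⟨_, hδ, ?_⟩
  have hlow : ∀ n : ℕ, 1 - (sInf (S n) + 1 / ((n : ℝ) + 1)) ≤
      (envLaw n).real {ω | X n ω ≤ sInf (S n) + 1 / ((n : ℝ) + 1)} := by
    intro n
    obtain ⟨ε, hε, hlt⟩ := exists_lt_of_csInf_lt (hne n)
      (lt_add_of_pos_right (sInf (S n)) (Nat.one_div_pos_of_nat (α := ℝ) (n := n)))
    have hcov : (Set.univ : Set (Env n)) ⊆
        {ω | X n ω ≤ sInf (S n) + 1 / ((n : ℝ) + 1)} ∪ {ω | ε < X n ω} := by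
      intro ω _
      rcases le_or_gt (X n ω) (sInf (S n) + 1 / ((n : ℝ) + 1)) with h' | h'
      · exact Or.inl h'
      · exact Or.inr (hlt.trans h')
    have h1 := measureReal_mono (μ := envLaw n) hcov
    have h2 := measureReal_union_le (μ := envLaw n)
      {ω | X n ω ≤ sInf (S n) + 1 / ((n : ℝ) + 1)} {ω | ε < X n ω}
    rw [probReal_univ] at h1
    linarith [hε.2]
  refine tendsto_of_tendsto_of_tendsto_of_le_of_le
    (g := fun n : ℕ => ENNReal.ofReal (1 - (sInf (S n) + 1 / ((n : ℝ) + 1)))) ?_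
    tendsto_const_nhds (fun n => ?_) (fun n => prob_le_one)
  · have := ENNReal.tendsto_ofReal ((tendsto_const_nhds (x := (1 : ℝ))).sub hδ)
    simpa using this
  · exact (ENNReal.ofReal_le_ofReal (hlow n)).trans_eq ofReal_measureReal

/-! ### The regime of large `β` -/

section

variable {n : ℕ}

lemma measurable_marginal (β : ℝ) (e : Edge n) :
    Measurable fun ω : Env n => marginal (conductance β ω) e := by
  have h : ∀ T : Finset (Edge n), Measurable fun ω : Env n => prodWeight (conductance β ω) T :=
    fun T => Finset.measurable_prod _ fun e _ => by unfold conductance; fun_prop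
  exact (Finset.measurable_sum _ fun T _ => h T).div (Finset.measurable_sum _ fun T _ => h T)

/-- As a function of the environment at `e`, the marginal of `e` is a logistic function. -/
lemma exists_marginal_update_eq (hn : 0 < n) (β : ℝ) (e : Edge n) (ω : Env n) :
    ∃ A B : ℝ, 0 ≤ A ∧ 0 ≤ B ∧ 0 < A + B ∧ ∀ t : ℝ,
      marginal (conductance β (Function.update ω e t)) e =
        A * Real.exp (-β * t) / (A * Real.exp (-β * t) + B) := by
  -- Neither `A` nor `B` depends on `ω e`: the factor of `e` is removed from the trees through `e`,
  -- and the other trees avoid it.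
  set A := ∑ T ∈ (spanningTrees n).filter (e ∈ ·), prodWeight (conductance β ω) (T.erase e) with hA
  set B := ∑ T ∈ (spanningTrees n).filter (e ∉ ·), prodWeight (conductance β ω) T with hB
  have hpos := fun T => prodWeight_pos (conductance_pos β ω) T
  have hcongr : ∀ (t : ℝ) (T : Finset (Edge n)), e ∉ T →
      prodWeight (conductance β (Function.update ω e t)) T = prodWeight (conductance β ω) T := by
    intro t T hT
    refine Finset.prod_congr rfl fun f hf => ?_
    have : f ≠ e := fun h => hT (h ▸ hf)
    simp [conductance, this]
  have hthrough : ∀ t : ℝ, treesThrough (conductance β (Function.update ω e t)) e =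
      A * Real.exp (-β * t) := by
    intro t
    rw [treesThrough, hA, Finset.sum_mul]
    refine Finset.sum_congr rfl fun T hT => ?_
    rw [← hcongr t _ (Finset.notMem_erase e T), prodWeight,
      ← Finset.prod_erase_mul _ _ (Finset.mem_filter.1 hT).2, prodWeight]
    congr 1
    simp [conductance]
  have htotal : ∀ t : ℝ, treesTotal (conductance β (Function.update ω e t)) =
      A * Real.exp (-β * t) + B := by
    intro t
    rw [← hthrough, treesTotal, ← Finset.sum_filter_add_sum_filter_not _ (e ∈ ·), treesThrough, hB]
    congr 1
    exact Finset.sum_congr rfl fun T hT => hcongr t T (Finset.mem_filter.1 hT).2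
  have hA0 : 0 ≤ A := Finset.sum_nonneg fun T _ => (hpos _).le
  have hB0 : 0 ≤ B := Finset.sum_nonneg fun T _ => (hpos _).le
  refine ⟨A, B, hA0, hB0, ?_, fun t => by rw [marginal, hthrough, htotal]⟩
  have h := treesTotal_pos (conductance_pos β (Function.update ω e 0)) hn
  rw [htotal] at h
  simpa using h

/-- The logistic function `G` satisfies `G' = -β G (1 - G)`, so the integral is `(G 0 - G 1) / β`
with `G` valued in `[0, 1]`. -/
lemma lintegral_logistic_variance_le {A B β : ℝ} (hA : 0 ≤ A) (hB : 0 ≤ B) (hAB : 0 < A + B)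
    (hβ : 0 < β) :
    ∫⁻ t, ENNReal.ofReal (A * Real.exp (-β * t) / (A * Real.exp (-β * t) + B) *
      (1 - A * Real.exp (-β * t) / (A * Real.exp (-β * t) + B))) ∂unifLaw ≤
        ENNReal.ofReal (1 / β) := by
  set G : ℝ → ℝ := fun t => A * Real.exp (-β * t) / (A * Real.exp (-β * t) + B) with hG
  have hden : ∀ t, 0 < A * Real.exp (-β * t) + B := by
    intro t
    rcases hA.eq_or_lt with h | h
    · rw [← h] at hAB ⊢; linarith
    · have := Real.exp_pos (-β * t); positivity
  have hG0 : ∀ t, 0 ≤ G t := fun t => by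
    have := hden t
    have := Real.exp_pos (-β * t)
    positivity
  have hG1 : ∀ t, G t ≤ 1 := fun t => by
    rw [hG, div_le_one (hden t)]; linarith
  have hderiv : ∀ t, HasDerivAt (fun t => -(1 / β) * G t) (G t * (1 - G t)) t := by
    intro t
    have h1 : HasDerivAt (fun t : ℝ => A * Real.exp (-β * t)) (A * (Real.exp (-β * t) * -β)) t := by
      have h2 : HasDerivAt (fun t : ℝ => -β * t) (-β) t := by
        simpa using (hasDerivAt_id t).const_mul (-β)
      exact h2.exp.const_mul A
    have h3 := (h1.div (h1.add_const B) (hden t).ne').const_mul (-(1 / β))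
    have heq : G t * (1 - G t) = -(1 / β) *
        ((A * (Real.exp (-β * t) * -β) * (A * Real.exp (-β * t) + B) -
          A * Real.exp (-β * t) * (A * (Real.exp (-β * t) * -β))) /
        (A * Real.exp (-β * t) + B) ^ 2) := by
      have := (hden t).ne'
      simp only [hG]
      generalize Real.exp (-β * t) = E at this ⊢
      field_simp
      ring
    rw [heq]
    exact h3
  have hcont : Continuous fun t => G t * (1 - G t) := by
    have hGc : Continuous G := by
      refine Continuous.div (by fun_prop) (by fun_prop) fun t => (hden t).ne'
    fun_prop
  have hnn : ∀ t, 0 ≤ G t * (1 - G t) := fun t => mul_nonneg (hG0 t) (by linarith [hG1 t])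
  rw [← ofReal_integral_eq_lintegral_ofReal]
  · refine ENNReal.ofReal_le_ofReal ?_
    change ∫ t, G t * (1 - G t) ∂unifLaw ≤ 1 / β
    rw [unifLaw, integral_Icc_eq_integral_Ioc, ← intervalIntegral.integral_of_le zero_le_one,
      intervalIntegral.integral_eq_sub_of_hasDerivAt (fun t _ => hderiv t)
        (hcont.intervalIntegrable _ _)]
    have h1 := mul_le_mul_of_nonneg_left (hG1 0) (one_div_pos.2 hβ).le
    have h2 := mul_nonneg (one_div_pos.2 hβ).le (hG0 1)
    linarith
  · exact hcont.continuousOn.integrableOn_Icc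
  · exact ae_of_all _ hnn

/-- Integrate over `ω e` first, with the environment frozen at the other edges; the logistic bound
is uniform in the frozen part. -/
lemma lintegral_marginal_variance_le (hn : 0 < n) {β : ℝ} (hβ : 0 < β) (e : Edge n) :
    ∫⁻ ω, ENNReal.ofReal (marginal (conductance β ω) e * (1 - marginal (conductance β ω) e))
      ∂envLaw n ≤ ENNReal.ofReal (1 / β) := by
  have hm := measurable_marginal β e
  have h := lintegral_le_of_lmarginal_le (μ := fun _ : Edge n => unifLaw) {e}
    (f := fun ω => ENNReal.ofReal
      (marginal (conductance β ω) e * (1 - marginal (conductance β ω) e)))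
    (g := fun _ => ENNReal.ofReal (1 / β)) (by fun_prop) measurable_const ?_
  · rw [envLaw_eq]
    simpa using h
  · rw [lmarginal_singleton, lmarginal_singleton]
    intro ω
    obtain ⟨A, B, hA, hB, hAB, heq⟩ := exists_marginal_update_eq hn β e ω
    simp only [heq]
    simpa using lintegral_logistic_variance_le hA hB hAB hβ

lemma overlap_eq_sub_sum (hn : 0 < n) (β : ℝ) (ω : Env n) : overlap β ω = n - 1 -
    ∑ e, marginal (conductance β ω) e * (1 - marginal (conductance β ω) e) := by
  rw [overlap_eq_sum_marginal_sq, ← sum_marginal (conductance_pos β ω) hn,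
    ← Finset.sum_sub_distrib]
  exact Finset.sum_congr rfl fun e _ => by ring

/-- Markov's inequality for the deficit, whose mean is at most `1 / β` per edge. -/
lemma measure_overlap_lt_le (hn : 0 < n) {β : ℝ} (hβ : 0 < β) {a : ℝ} (ha : 0 < a) :
    (envLaw n).real {ω | overlap β ω ≤ n - 1 - a} ≤ n * (n - 1) / 2 / β / a := by
  set Y : Env n → ℝ := fun ω =>
    ∑ e, marginal (conductance β ω) e * (1 - marginal (conductance β ω) e) with hY
  have hnn : ∀ (ω : Env n) (e : Edge n),
      0 ≤ marginal (conductance β ω) e * (1 - marginal (conductance β ω) e) := fun ω e =>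
    mul_nonneg (marginal_nonneg (conductance_pos β ω) e)
      (by linarith [marginal_le_one (conductance_pos β ω) e])
  have hmeas : ∀ e : Edge n, Measurable fun ω : Env n => ENNReal.ofReal
      (marginal (conductance β ω) e * (1 - marginal (conductance β ω) e)) := fun e => by
    have hm := measurable_marginal β e
    fun_prop
  have hYsum : ∀ ω, ENNReal.ofReal (Y ω) = ∑ e, ENNReal.ofReal
      (marginal (conductance β ω) e * (1 - marginal (conductance β ω) e)) := fun ω =>
    ENNReal.ofReal_sum_of_nonneg fun e _ => hnn ω e
  have hE : ∫⁻ ω, ENNReal.ofReal (Y ω) ∂envLaw n ≤ ENNReal.ofReal (n * (n - 1) / 2 / β) := by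
    simp only [hYsum]
    rw [lintegral_finsetSum _ fun e _ => hmeas e]
    refine (Finset.sum_le_sum fun e _ => lintegral_marginal_variance_le hn hβ e).trans_eq ?_
    rw [Finset.sum_const, nsmul_eq_mul, ← card_edge, ← ENNReal.ofReal_natCast,
      ← ENNReal.ofReal_mul (by positivity)]
    congr 1; ring
  have hmeasY : Measurable fun ω => ENNReal.ofReal (Y ω) := by
    simp only [hYsum]
    exact Finset.measurable_sum _ fun e _ => hmeas e
  have hsub : {ω : Env n | overlap β ω ≤ n - 1 - a} ⊆
      {ω | ENNReal.ofReal a ≤ ENNReal.ofReal (Y ω)} := by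
    intro ω hω
    refine ENNReal.ofReal_le_ofReal ?_
    have h : overlap β ω ≤ n - 1 - a := hω
    rw [overlap_eq_sub_sum hn] at h
    linarith
  have hM := meas_ge_le_lintegral_div (μ := envLaw n) hmeasY.aemeasurable
    (ENNReal.ofReal_pos.2 ha).ne' ENNReal.ofReal_ne_top
  refine ENNReal.toReal_le_of_le_ofReal ?_ ((measure_mono hsub).trans (hM.trans ?_))
  · have : (1 : ℝ) ≤ n := by exact_mod_cast hn
    have : (0 : ℝ) ≤ n - 1 := by linarith
    positivity
  · rw [ENNReal.ofReal_div_of_pos ha]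
    gcongr

end

lemma overlap_nonneg {n : ℕ} (β : ℝ) (ω : Env n) : 0 ≤ overlap β ω := by
  rw [overlap_eq_sum_marginal_sq]
  exact Finset.sum_nonneg fun e _ => sq_nonneg _

/-- The overlap is asymptotic to `n` already when `n = o(β)`. -/
lemma overlap_of_large_beta {β : ℕ → ℝ} (hβ : ∀ᶠ n in atTop, 0 < β n)
    (h : Tendsto (fun n : ℕ => (n : ℝ) / β n) atTop (𝓝 0)) :
    ∃ δ : ℕ → ℝ, Tendsto δ atTop (𝓝 0) ∧ WithHighProbability fun n => {ω |
      (1 - δ n) * (n : ℝ) ≤ overlap (β n) ω ∧ overlap (β n) ω ≤ (n : ℝ)} := by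
  suffices hX : ∀ ε : ℝ, 0 < ε → Tendsto (fun n : ℕ => (envLaw n).real
      {ω | ε < 1 - overlap (β n) ω / n}) atTop (𝓝 0) by
    obtain ⟨δ, hδ, hP⟩ := exists_tendsto_zero_withHighProbability hX
    refine ⟨δ, hδ, ?_⟩
    refine tendsto_of_tendsto_of_tendsto_of_le_of_le hP tendsto_const_nhds
      (fun n => measure_mono fun ω hω => ⟨?_, overlap_le _ _⟩) (fun n => prob_le_one)
    have hω' : 1 - overlap (β n) ω / n ≤ δ n := hω
    rcases n.eq_zero_or_pos with rfl | hn
    · simpa using overlap_nonneg (β 0) ω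
    · have : (0 : ℝ) < n := by exact_mod_cast hn
      rwa [sub_le_comm, le_div_iff₀ this] at hω'
  intro ε hε
  have hlim : Tendsto (fun n : ℕ => 1 / ε * ((n : ℝ) / β n)) atTop (𝓝 0) := by
    simpa using h.const_mul (1 / ε)
  refine squeeze_zero' (Eventually.of_forall fun n => measureReal_nonneg) ?_ hlim
  -- With `n ≥ 2 / ε`, the 1 in `n - 1` costs at most half of the allowed deficit `ε * n`.
  filter_upwards [hβ, eventually_ge_atTop 1,
    tendsto_natCast_atTop_atTop.eventually_ge_atTop (2 / ε)] with n hβn hn hnε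
  have hnR : (1 : ℝ) ≤ n := by exact_mod_cast hn
  rw [div_le_iff₀ hε] at hnε
  have hsub : {ω : Env n | ε < 1 - overlap (β n) ω / n} ⊆
      {ω | overlap (β n) ω ≤ n - 1 - ε * n / 2} := by
    intro ω hω
    have h1 : overlap (β n) ω / n < 1 - ε := by
      have : ε < 1 - overlap (β n) ω / n := hω
      linarith
    rw [div_lt_iff₀ (by linarith)] at h1
    change overlap (β n) ω ≤ n - 1 - ε * n / 2
    linarith
  refine (measureReal_mono hsub).trans
    ((measure_overlap_lt_le hn hβn (by positivity)).trans ?_)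
  rw [div_div, div_div, one_div_mul_eq_div, div_div, div_le_div_iff₀ (by positivity) (by positivity)]
  have : 0 ≤ n * (β n * ε) := by positivity
  nlinarith

/-! ### The regime of small `β` -/

section

variable {β : ℕ → ℝ}

lemma eventually_mul_log_le (hβ : ∀ n, 0 < β n)
    (h : β =o[atTop] (fun n : ℕ => (n : ℝ) / Real.log n)) {K : ℝ} (hK : 0 < K) :
    ∀ᶠ n : ℕ in atTop, K * Real.log n ≤ n * meanConductance (β n) := by
  have hlog : (fun n : ℕ => Real.log n) =o[atTop] fun n : ℕ => (n : ℝ) :=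
    Real.isLittleO_log_id_atTop.comp_tendsto tendsto_natCast_atTop_atTop
  -- The goal `K * log n * (1 + β n) ≤ n` splits into two halves, one for `log n` and one for `β n *
  -- log n`.
  filter_upwards [h.bound (show 0 < 1 / (2 * K) by positivity),
    hlog.bound (show 0 < 1 / (2 * K) by positivity), eventually_ge_atTop 2] with n h1 h2 hn
  have hnR : (2 : ℝ) ≤ n := by exact_mod_cast hn
  have hl : 0 < Real.log n := Real.log_pos (by linarith)
  rw [Real.norm_of_nonneg (hβ n).le, Real.norm_of_nonneg (by positivity), div_mul_div_comm,
    one_mul, le_div_iff₀ (by positivity)] at h1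
  rw [Real.norm_of_nonneg hl.le, Real.norm_of_nonneg (by positivity), one_div_mul_eq_div,
    le_div_iff₀ (by positivity)] at h2
  have h3 : K * Real.log n ≤ n * (1 / (1 + β n)) := by
    have := hβ n
    rw [mul_one_div, le_div_iff₀ (by positivity)]
    nlinarith
  exact h3.trans (mul_le_mul_of_nonneg_left (one_div_le_meanConductance (hβ n)) (by positivity))

lemma tendsto_mul_exp_neg (hβ : ∀ n, 0 < β n)
    (h : β =o[atTop] (fun n : ℕ => (n : ℝ) / Real.log n)) {a : ℝ} (ha : 0 < a) :
    Tendsto (fun n : ℕ => (n : ℝ) * Real.exp (-(a * (n * meanConductance (β n))))) atTop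
      (𝓝 0) := by
  refine squeeze_zero' (Eventually.of_forall fun n => by positivity) ?_
    tendsto_one_div_atTop_nhds_zero_nat
  -- With `K = 2 / a` the exponential is at most `n ^ (-2)`, so the product is at most `1 / n`.
  filter_upwards [eventually_mul_log_le hβ h (show 0 < 2 / a by positivity),
    eventually_ge_atTop 1] with n h1 hn
  have hnR : (0 : ℝ) < n := by exact_mod_cast hn
  have h2 : 2 * Real.log n ≤ a * (n * meanConductance (β n)) := by
    have := mul_le_mul_of_nonneg_left h1 ha.le
    rwa [← mul_assoc, mul_div_cancel₀ _ ha.ne'] at this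
  calc _ ≤ (n : ℝ) * Real.exp (-(2 * Real.log n)) := by gcongr
    _ = 1 / n := by
      rw [Real.exp_neg, two_mul, Real.exp_add, Real.exp_log hnR]
      field_simp

lemma tendsto_measure_not_isTypical (hβ : ∀ n, 0 < β n)
    (h : β =o[atTop] (fun n : ℕ => (n : ℝ) / Real.log n)) {ε : ℝ} (hε : 0 < ε) (hε1 : ε ≤ 1) :
    Tendsto (fun n => (envLaw n).real {ω | ¬ IsTypical (β n) ε ω}) atTop (𝓝 0) := by
  have h1 := tendsto_mul_exp_neg hβ h (show (0 : ℝ) < 1 / 32 by norm_num)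
  have h2 := (tendsto_mul_exp_neg hβ h (show 0 < ε ^ 2 / 16 by positivity)).const_mul 4
  have h3 := (((Real.continuous_exp.tendsto 0).comp h1).sub_const 1).add h2
  simp only [Real.exp_zero, sub_self, mul_zero, add_zero] at h3
  refine squeeze_zero' (Eventually.of_forall fun n => measureReal_nonneg) ?_ h3
  filter_upwards [eventually_ge_atTop 2] with n hn
  have hnR : (2 : ℝ) ≤ n := by exact_mod_cast hn
  refine (measure_not_isTypical_le hn (hβ n) hε hε1).trans (add_le_add (le_of_eq ?_) ?_)
  · simp only [Function.comp]
    congr 4; ring_nf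
  · exact (mul_le_mul_of_nonneg_right (show (n : ℝ) + 3 ≤ 4 * n by linarith)
      (Real.exp_pos _).le).trans_eq (mul_assoc _ _ _)

/-- The overlap when `β = o(n / log n)`. -/
lemma overlap_of_small_beta (hβ : ∀ n, 0 < β n)
    (h : β =o[atTop] (fun n : ℕ => (n : ℝ) / Real.log n)) :
    ∃ δ : ℕ → ℝ, Tendsto δ atTop (𝓝 0) ∧ WithHighProbability fun n => {ω |
      |overlap (β n) ω -
          β n * ((1 - Real.exp (-2 * β n)) / (1 - Real.exp (-β n)) ^ 2)| ≤
        δ n * (β n * ((1 - Real.exp (-2 * β n)) / (1 - Real.exp (-β n)) ^ 2))} := by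
  have hm : ∀ n, 0 < β n * ((1 - Real.exp (-2 * β n)) / (1 - Real.exp (-β n)) ^ 2) := fun n => by
    rw [limit_overlap_eq (hβ n)]
    have h1 := meanConductance_pos (hβ n)
    have h2 := meanConductance_pos (show 0 < 2 * β n by linarith [hβ n])
    positivity
  suffices hX : ∀ ε : ℝ, 0 < ε → Tendsto (fun n : ℕ => (envLaw n).real
      {ω | ε < |overlap (β n) ω -
        β n * ((1 - Real.exp (-2 * β n)) / (1 - Real.exp (-β n)) ^ 2)| /
          (β n * ((1 - Real.exp (-2 * β n)) / (1 - Real.exp (-β n)) ^ 2))}) atTop (𝓝 0) by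
    obtain ⟨δ, hδ, hP⟩ := exists_tendsto_zero_withHighProbability hX
    refine ⟨δ, hδ, ?_⟩
    simpa only [div_le_iff₀ (hm _)] using hP
  intro ε hε
  set η := min 1 (ε / 600) with hη
  have hη0 : 0 < η := lt_min one_pos (by positivity)
  have hη1 : η ≤ 1 := min_le_left _ _
  have hηε : 600 * η ≤ ε := by
    have := min_le_right 1 (ε / 600)
    linarith
  refine squeeze_zero' (Eventually.of_forall fun n => measureReal_nonneg) ?_
    (tendsto_measure_not_isTypical hβ h hη0 hη1)
  have hlog : ∀ᶠ n : ℕ in atTop, 1 ≤ Real.log n :=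
    (Real.tendsto_log_atTop.comp tendsto_natCast_atTop_atTop).eventually_ge_atTop 1
  filter_upwards [eventually_ge_atTop 2, hlog,
    eventually_mul_log_le hβ h (show 0 < 1 / η by positivity),
    tendsto_natCast_atTop_atTop.eventually_ge_atTop (1 / η)] with n hn hln hq hnη
  refine measureReal_mono fun ω hω htyp => ?_
  rw [div_le_iff₀ hη0] at hnη
  have hq' : 1 / η * 1 ≤ n * meanConductance (β n) :=
    (mul_le_mul_of_nonneg_left hln (by positivity)).trans hq
  rw [mul_one, div_le_iff₀ hη0] at hq'
  have h1 := htyp.abs_overlap_sub_le hn (hβ n) hη0 hη1 (by linarith) (by linarith)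
  rw [← div_le_iff₀ (hm n)] at h1
  exact absurd (h1.trans hηε) (not_le.2 hω)

end

end RSTRE

end

theorem theorem1p1 :
    (∀ β : ℕ → ℝ, (∀ n, 0 < β n) →
      β =o[atTop] (fun n : ℕ => (n : ℝ) / Real.log n) →
      ∃ δ : ℕ → ℝ, Tendsto δ atTop (𝓝 0) ∧
        RSTRE.WithHighProbability fun n => {ω |
          |RSTRE.overlap (β n) ω -
              β n * ((1 - Real.exp (-2 * β n)) / (1 - Real.exp (-β n)) ^ 2)| ≤
            δ n * (β n * ((1 - Real.exp (-2 * β n)) / (1 - Real.exp (-β n)) ^ 2))}) ∧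
    (∀ β : ℕ → ℝ, (∀ n, 0 ≤ β n) →
      (fun n : ℕ => (n : ℝ) * Real.log n ^ 2) =o[atTop] β →
      ∃ δ : ℕ → ℝ, Tendsto δ atTop (𝓝 0) ∧
        RSTRE.WithHighProbability fun n => {ω |
          (1 - δ n) * (n : ℝ) ≤ RSTRE.overlap (β n) ω ∧
            RSTRE.overlap (β n) ω ≤ (n : ℝ)}) := by
  refine ⟨fun β hβ h => RSTRE.overlap_of_small_beta hβ h, fun β hβ h => ?_⟩
  have hlog : ∀ᶠ n : ℕ in atTop, 1 ≤ Real.log n :=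
    (Real.tendsto_log_atTop.comp tendsto_natCast_atTop_atTop).eventually_ge_atTop 1
  -- The squared logarithm is only discarded: `n = o(β)` suffices, and it also makes `β n`
  -- eventually positive.
  have hn : (fun n : ℕ => (n : ℝ)) =o[atTop] β := by
    refine IsBigO.trans_isLittleO (IsBigO.of_bound 1 ?_) h
    filter_upwards [hlog] with n hn
    rw [one_mul, Real.norm_of_nonneg (by positivity), Real.norm_of_nonneg (by positivity)]
    exact le_mul_of_one_le_right (by positivity) (one_le_pow₀ hn)
  refine RSTRE.overlap_of_large_beta ?_ hn.tendsto_div_nhds_zero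
  filter_upwards [hn.bound one_pos, eventually_ge_atTop 1] with n h1 h2
  have hnR : (1 : ℝ) ≤ n := by exact_mod_cast h2
  rw [Real.norm_of_nonneg (by positivity), Real.norm_of_nonneg (hβ n), one_mul] at h1
  linarith
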